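/- **Proposition 3.7.** Let $k$ be an algebraically closed field, let $n\ge 2$, and let $\Delta$ be the cyclic quiver with vertex set $I=\mathbb Z/n\mathbb Z=\{1,\dots,n\}$ and arrows $i\to i+1$ $(i\in I)$. Consider finite-dimensional nilpotent representations $V=(V_i,f_i)_{i\in I}$ of $\Delta$ over $k$, i.e. those for which $f_n\cdots f_2f_1:V_1\to V_1$ is nilpotent. For $i\in I$ and $l\ge1$ let $S_i[l]$ be the indecomposable nilpotent representation of length $l$ with top the simple representation $S_i=S_i[1]$: it has a basis $e_0,\dots,e_{l-1}$ with $e_t$ at the vertex $i+t$, and the arrows send $e_t\mapsto e_{t+1}$ and $e_{l-1}\mapsto 0$; put $S_i[0]=0$. Let $\Pi$ be the set of $n$-tuples $\pi=(\pi^{(1)},\dots,\pi^{(n)})$ of partitions, let $\tilde p=(\tilde p_1,\tilde p_2,\dots)$ denote the dual of a partition $p$, and for $\pi\in\Pi$ put $$M(\pi)=\bigoplus_{i\in I,\ j\ge1}S_i[\tilde\pi^{(i)}_j].$$ For nilpotent $M,N$, an extension of $M$ by $N$ is a representation $E$ with an exact sequence $0\to N\to E\to M\to0$. A generic extension of $M$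 by $N$ is a nilpotent extension $G$ of $M$ by $N$ whose orbit $\mathcal O_G$ has maximal dimension among the orbits $\mathcal O_E$ of all nilpotent extensions $E$ of $M$ by $N$. Here, for a representation $E$ with dimension vector $\mathbf d=(d_i)_{i\in I}$, the orbit $\mathcal O_E$ is the set of points of the affine space $\prod_{i\in I}k^{d_{i+1}\times d_i}$ whose associated representation is isomorphic to $E$. A generic extension, unique up to isomorphism, is denoted $M*N$. For $i\in I$ define $\sigma_i^+:\Pi\to\Pi$, $\sigma_i^+\pi=\lambda$, by $$\lambda^{(i)}=\pi^{(i)}+\mathbf 1_{\tilde\pi^{(i+1)}_1+1},\qquad \lambda^{(i+1)}=\pi^{(i+1)}-\mathbf 1_{\tilde\pi^{(i+1)}_1},\qquad \lambda^{(j)}=\pi^{(j)}\ \ (j\ne i,i+1),$$ where $\mathbf 1_a=(1,\dots,1)$ with $a$ ones and sums and differences of sequences are termwise. (So $\sigma_i^+$ removes the largest column of the Young diagram of $\pi^{(i+1)}$, if there is one, and adds a column one longer, of length $\tilde\pi^{(i+1)}_1+1$, to that of $\pi^{(i)}$.) Then for every $i\in I$ and $\pi\in\Pi$ $$S_i*M(\pi)\cong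 M(\sigma_i^+\pi),$$ that is, a representation $G$ of $\Delta$ is a generic extension of $S_i$ by $M(\pi)$ if and only if $G\cong M(\sigma_i^+\pi)$. -/

import Mathlib

universe u

namespace CyclicQuiver

/-! ## Partitions and the set of multipartitions -/

/-- A partition: a weakly decreasing sequence of natural numbers with finitely many non-zero
terms. The term `parts m` is the `(m + 1)`-st term in the usual one-based numbering. -/
@[ext]
structure Part where
  parts : ℕ → ℕ
  antitone : Antitone parts
  finite : ∃ N, ∀ m, N ≤ m → parts m = 0

namespace Part

theorem finite_setOf_lt (p : Part) (j : ℕ) : {m | j < p.parts m}.Finite := by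
  obtain ⟨N, hN⟩ := p.finite
  refine (Set.finite_lt_nat N).subset fun m hm => ?_
  by_contra h
  have := hN m (not_lt.mp h)
  simp only [Set.mem_ofPred_eq] at hm
  omega

/-- The dual (conjugate) partition: its `(j + 1)`-st term is the number of terms of `p` that are
at least `j + 1`, i.e. the length of the `(j + 1)`-st column of the Young diagram of `p`. -/
noncomputable def dual (p : Part) : Part where
  parts j := {m | j < p.parts m}.ncard
  antitone := fun a b hab =>
    Set.ncard_le_ncard (fun m (hm : b < p.parts m) => lt_of_le_of_lt hab hm) (p.finite_setOf_lt a)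
  finite := by
    refine ⟨p.parts 0, fun j hj => ?_⟩
    have : {m | j < p.parts m} = ∅ := by
      ext m
      have := p.antitone (Nat.zero_le m)
      simp only [Set.mem_ofPred_eq, Set.mem_empty_iff_false, iff_false]
      omega
    rw [this, Set.ncard_empty]

/-- The number of non-zero terms is the index of the first zero term. -/
theorem lt_dual_zero_iff (p : Part) (m : ℕ) : m < p.dual.parts 0 ↔ 0 < p.parts m := by
  classical
  obtain ⟨N, hN⟩ := p.finite
  have hex : ∃ N, p.parts N = 0 := ⟨N, hN N le_rfl⟩
  have hset : {m | 0 < p.parts m} = Set.Iio (Nat.find hex) := by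
    ext m
    simp only [Set.mem_ofPred_eq, Set.mem_Iio, Nat.lt_find_iff]
    constructor
    · intro h a ha
      have := p.antitone ha
      omega
    · intro h
      exact Nat.pos_of_ne_zero (h m le_rfl)
  have hcard : p.dual.parts 0 = Nat.find hex := by
    change {m | 0 < p.parts m}.ncard = _
    rw [hset, ← Finset.coe_Iio, Set.ncard_coe_finset, Nat.card_Iio]
  rw [hcard]
  exact (Set.ext_iff.mp hset m).symm

end Part

/-- The sequence `(1, …, 1, 0, 0, …)` with `a` ones. -/
def ones (a m : ℕ) : ℕ := if m < a then 1 else 0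

namespace Part

/-- The partition `p + (1, …, 1)` with `a` ones (termwise sum). -/
def addOnes (p : Part) (a : ℕ) : Part where
  parts m := p.parts m + ones a m
  antitone := fun m m' h => by
    have := p.antitone h
    simp only [ones]
    split_ifs <;> omega
  finite := by
    obtain ⟨N, hN⟩ := p.finite
    refine ⟨max N a, fun m hm => ?_⟩
    rw [hN m (le_trans (le_max_left _ _) hm), ones, if_neg]
    have := le_trans (le_max_right N a) hm
    omega

/-- The partition `p - (1, …, 1)` (termwise difference), where the number of ones is the number of
non-zero terms of `p`. -/
noncomputable def subOnes (p : Part) : Part where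
  parts m := p.parts m - ones (p.dual.parts 0) m
  antitone := fun m m' h => by
    have := p.antitone h
    have h1 := p.lt_dual_zero_iff m
    have h2 := p.lt_dual_zero_iff m'
    simp only [ones]
    split_ifs <;> omega
  finite := by
    obtain ⟨N, hN⟩ := p.finite
    exact ⟨N, fun m hm => by simp [hN m hm]⟩

end Part

/-- The set `Π` of `n`-tuples of partitions; the vertex set `I = {1, …, n}` is `ℤ/nℤ`. -/
abbrev MultiPart (n : ℕ) : Type := ZMod n → Part

/-- The map `σ_i⁺ : Π → Π`. -/
noncomputable def sigmaPlus {n : ℕ} (i : ZMod n) (π : MultiPart n) : MultiPart n := fun j =>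
  if j = i then (π i).addOnes ((π (i + 1)).dual.parts 0 + 1)
  else if j = i + 1 then (π (i + 1)).subOnes
  else π j

/-! ## Representations of the cyclic quiver -/

/-- A finite-dimensional representation over `k` of the cyclic quiver with vertex set `ℤ/nℤ` and
arrows `i ⟶ i + 1`. -/
structure Rep (k : Type u) [Field k] (n : ℕ) where
  V : ZMod n → Type u
  [addCommGroup : ∀ i, AddCommGroup (V i)]
  [module : ∀ i, Module k (V i)]
  [finiteDimensional : ∀ i, FiniteDimensional k (V i)]
  map : ∀ i, V i →ₗ[k] V (i + 1)

attribute [instance] Rep.addCommGroup Rep.module Rep.finiteDimensional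

namespace Rep

variable {k : Type u} [Field k] {n : ℕ}

/-- The identification `V i = V j` for equal vertices `i` and `j`. -/
def transport (M : Rep k n) {i j : ZMod n} (h : i = j) : M.V i →ₗ[k] M.V j :=
  h ▸ LinearMap.id

/-- The composition of `m` consecutive arrows, starting at the vertex `i`. -/
def path (M : Rep k n) (i : ZMod n) : (m : ℕ) → (M.V i →ₗ[k] M.V (i + (m : ZMod n)))
  | 0 => M.transport (by simp)
  | m + 1 => M.transport (by push_cast; ring) ∘ₗ M.map (i + (m : ZMod n)) ∘ₗ M.path i m

/-- The composition of the `n` arrows of the cycle, starting and ending at the vertex `i`. -/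
def cycle (M : Rep k n) (i : ZMod n) : Module.End k (M.V i) :=
  M.transport (by simp) ∘ₗ M.path i n

/-- A representation is nilpotent if the composition of all arrows, starting and ending at the
vertex `1`, is nilpotent. -/
def IsNilp (M : Rep k n) : Prop := IsNilpotent (M.cycle 1)

/-- A morphism of representations. -/
structure Hom (M N : Rep k n) where
  app : ∀ i, M.V i →ₗ[k] N.V i
  comm : ∀ i (v : M.V i), app (i + 1) (M.map i v) = N.map i (app i v)

/-- The representations `M` and `N` are isomorphic. -/
def IsIso (M N : Rep k n) : Prop := ∃ φ : Hom M N, ∀ i, Function.Bijective (φ.app i)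

/-- `E` is an extension of `M` by `N`: there is an exact sequence `0 → N → E → M → 0`. -/
def IsExtension (E M N : Rep k n) : Prop :=
  ∃ (ι : Hom N E) (p : Hom E M), ∀ i, Function.Injective (ι.app i) ∧
    Function.Exact (ι.app i) (p.app i) ∧ Function.Surjective (p.app i)

/-- The dimension vector. -/
noncomputable def dimVec (M : Rep k n) (i : ZMod n) : ℕ := Module.finrank k (M.V i)

/-! ## The representation variety and orbits -/

/-- The index set of the coordinates of the affine space
`R(d) = ∏ i, k ^ (d (i + 1) × d i)`: an arrow `i ⟶ i + 1` and the position of a matrix entry. -/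
abbrev Coord (d : ZMod n → ℕ) : Type := Σ i : ZMod n, Fin (d (i + 1)) × Fin (d i)

/-- The representation `(k ^ (d i), f_i)_i` given by a point of `R(d)`. -/
noncomputable def ofPoint (d : ZMod n → ℕ) (x : Coord d → k) : Rep k n where
  V i := Fin (d i) → k
  map i := Matrix.toLin' (Matrix.of fun a b => x ⟨i, a, b⟩)

/-- The orbit `O_M` in `R(d)`: all points whose representation is isomorphic to `M`. Isomorphisms
between two representations `(k ^ (d i), f_i)_i` are exactly the elements `(g_i)_i` of
`GL(d) = ∏ i, GL_{d i}(k)` that carry one to the other under `(g f)_i = g_{i+1} f_i g_i⁻¹`, so this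
is a `GL(d)`-orbit (for `d` the dimension vector of `M`). -/
def orbit (d : ZMod n → ℕ) (M : Rep k n) : Set (Coord d → k) :=
  {x | IsIso (ofPoint d x) M}

/-- The dimension of a subset `S` of an affine space over `k`: the Krull dimension of
the coordinate ring of its Zariski closure. For a locally closed subset (such as an orbit of an
algebraic group), this is the dimension of the variety `S`. -/
noncomputable def zariskiDim {σ : Type} (S : Set (σ → k)) : WithBot ℕ∞ :=
  ringKrullDim (MvPolynomial σ k ⧸ MvPolynomial.vanishingIdeal k S)

/-- The dimension of the orbit `O_M` in `R(d)`, `d` being the dimension vector of `M`. -/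
noncomputable def orbitDim (M : Rep k n) : WithBot ℕ∞ := zariskiDim (orbit M.dimVec M)

/-- `G` is a generic extension of `M` by `N`: a nilpotent extension of `M` by `N` whose orbit
has maximal dimension among the orbits of all such extensions. -/
def IsGenericExtension (G M N : Rep k n) : Prop :=
  (G.IsNilp ∧ IsExtension G M N) ∧
    ∀ E : Rep k n, E.IsNilp → IsExtension E M N → E.orbitDim ≤ G.orbitDim

/-! ## The standard nilpotent representations -/

/-- The direct sum of a finite family of representations. -/
def directSum {ι : Type} [Finite ι] (R : ι → Rep k n) : Rep k n where
  V j := ∀ s, (R s).V j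
  map j := LinearMap.pi fun s => (R s).map j ∘ₗ LinearMap.proj s

/-- The indecomposable representation `S_i[l]` of length `l` with top `S_i`. It has a basis
`e_0, …, e_{l-1}`, where `e_t` sits at the vertex `i + t`, and the arrows map `e_t` to `e_{t+1}`
and `e_{l-1}` to `0`. A vector at the vertex `j` is given by its coordinates at those `e_t` with
`i + t = j`. For `l = 0` this is the zero representation. -/
def indec (k : Type u) [Field k] {n : ℕ} (i : ZMod n) (l : ℕ) : Rep k n where
  V j := {t : Fin l // i + ((t : ℕ) : ZMod n) = j} → k
  map j :=
    { toFun := fun v t =>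
        if h : 0 < (t.1 : ℕ) then
          v ⟨⟨(t.1 : ℕ) - 1, by omega⟩, by
            have ht := t.2
            have hs : (((t.1 : ℕ) : ℕ) : ZMod n) = (((t.1 : ℕ) - 1 : ℕ) : ZMod n) + 1 := by
              rw [← Nat.cast_succ]
              congr 1
              omega
            rw [hs, ← add_assoc] at ht
            exact add_right_cancel ht⟩
        else 0
      map_add' := fun v w => by
        funext t
        by_cases h : 0 < (t.1 : ℕ) <;> simp [h]
      map_smul' := fun c v => by
        funext t
        by_cases h : 0 < (t.1 : ℕ) <;> simp [h] }

/-- The simple representation `S_i`: one-dimensional, concentrated at the vertex `i`. -/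
def simple (k : Type u) [Field k] {n : ℕ} (i : ZMod n) : Rep k n := indec k i 1

/-- The representation `M(π) = ⨁ i, ⨁ j, S_i[l_{i,j}]`, where `l_{i,j}` runs over the non-zero terms
of the dual partition of `π i` (there are `(π i).parts 0` of them). -/
noncomputable def ofMultiPart (k : Type u) [Field k] {n : ℕ} [NeZero n] (π : MultiPart n) :
    Rep k n :=
  directSum fun s : (Σ i : ZMod n, Fin ((π i).parts 0)) => indec k s.1 ((π s.1).dual.parts s.2)

end Rep

end CyclicQuiver

/-!
The extensions of `S_i` by `M(π) = ⨁ S_v[l]` are governed by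
`Ext¹(S_i, M(π)) = M(π)_{i+1} / f(M(π)_i)`, which has a basis given by the tops of the summands
`S_{i+1}[l]`. Let `l` be the maximal length of such a summand (`l = 0` if there is none).

* If the class of an extension has a non-zero coefficient at a summand `S_{i+1}[l]` of maximal
  length, an automorphism of `M(π)` moves it to the top of that summand
  (`isIso_ext_topCocycle`), and the extension just replaces `S_{i+1}[l]` by `S_i[l+1]`
  (`isIso_ext_strings_update`). Counting columns of Young diagrams shows that the result is
  `M(σ_i⁺ π)` (`card_label_sigmaPlus`). If `l = 0`, every extension splits; this is treated as the
  replacement of a zero summand `S_{i+1}[0]` by `S_i[1]`.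
* For every other extension `E`, the path of length `l` starting at `i` has smaller rank than in
  `M(σ_i⁺ π)` (`isIso_or_pathRank_lt`).

The orbit dimensions are then compared without being computed. Adding to the class of any
extension `E` a multiple `t` of the top of a longest summand gives `M(σ_i⁺ π)` for all but at most
one `t`, so the orbit of `E` lies in the closure of the orbit of `M(σ_i⁺ π)`
(`vanishingIdeal_orbit_le`). In the second case the closures differ because the rank of a path is
semicontinuous (`exists_mem_vanishingIdeal_of_pathRank_lt`). Since orbits are irreducible
(`isPrime_vanishingIdeal_orbit`), a proper inclusion of their closures forces the dimension to
drop (`zariskiDim_add_one_le`).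
-/

namespace CyclicQuiver

namespace Rep

/-! ### Isomorphisms, paths and nilpotency -/

section Basic

variable {k : Type u} [Field k] {n : ℕ}

/-- The composition of two morphisms. -/
def Hom.comp {M N P : Rep k n} (ψ : Hom N P) (φ : Hom M N) : Hom M P where
  app i := ψ.app i ∘ₗ φ.app i
  comm i v := by simp [φ.comm, ψ.comm]

theorem IsIso.trans {M N P : Rep k n} (h : IsIso M N) (h' : IsIso N P) : IsIso M P := by
  obtain ⟨φ, hφ⟩ := h
  obtain ⟨ψ, hψ⟩ := h'
  exact ⟨ψ.comp φ, fun i => (hψ i).comp (hφ i)⟩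

theorem IsIso.symm {M N : Rep k n} (h : IsIso M N) : IsIso N M := by
  obtain ⟨φ, hφ⟩ := h
  let e := fun i => LinearEquiv.ofBijective (φ.app i) (hφ i)
  refine ⟨⟨fun i => (e i).symm, fun i v => ?_⟩, fun i => (e i).symm.bijective⟩
  apply (e (i + 1)).injective
  have h1 := φ.comm i ((e i).symm v)
  have h2 : φ.app i ((e i).symm v) = v := (e i).apply_symm_apply v
  rw [h2] at h1
  rw [LinearEquiv.coe_coe, LinearEquiv.coe_coe, LinearEquiv.apply_symm_apply]
  exact h1.symm

theorem IsIso.dimVec_eq {M N : Rep k n} (h : IsIso M N) : M.dimVec = N.dimVec := by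
  obtain ⟨φ, hφ⟩ := h
  funext i
  exact (LinearEquiv.ofBijective (φ.app i) (hφ i)).finrank_eq

theorem Hom.app_transport {M N : Rep k n} (φ : Hom M N) {i j : ZMod n} (h : i = j) (v : M.V i) :
    φ.app j (M.transport h v) = N.transport h (φ.app i v) := by
  subst h; rfl

theorem Hom.app_path {M N : Rep k n} (φ : Hom M N) (i : ZMod n) (m : ℕ) (v : M.V i) :
    φ.app _ (M.path i m v) = N.path i m (φ.app i v) := by
  induction m with
  | zero => exact φ.app_transport _ v
  | succ m ih => simp only [path, LinearMap.comp_apply, φ.app_transport, φ.comm, ih]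

/-- The rank of a path. -/
noncomputable def pathRank (M : Rep k n) (i : ZMod n) (m : ℕ) : ℕ :=
  Module.finrank k (LinearMap.range (M.path i m))

theorem IsIso.pathRank_eq {M N : Rep k n} (h : IsIso M N) (i : ZMod n) (m : ℕ) :
    M.pathRank i m = N.pathRank i m := by
  obtain ⟨φ, hφ⟩ := h
  have h1 : LinearMap.range (N.path i m) =
      (LinearMap.range (M.path i m)).map (φ.app (i + (m : ZMod n))) := by
    ext y
    constructor
    · rintro ⟨v, rfl⟩
      obtain ⟨v, rfl⟩ := (hφ i).2 v
      exact ⟨_, ⟨v, rfl⟩, φ.app_path i m v⟩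
    · rintro ⟨_, ⟨v, rfl⟩, rfl⟩
      exact ⟨φ.app i v, (φ.app_path i m v).symm⟩
  unfold pathRank
  rw [h1]
  exact (Submodule.equivMapOfInjective _ (hφ _).1 _).finrank_eq

theorem IsExtension.of_isIso {E E' M N : Rep k n} (h : IsExtension E M N) (e : IsIso E' E) :
    IsExtension E' M N := by
  obtain ⟨ι, p, h⟩ := h
  obtain ⟨φ, hφ⟩ := e
  obtain ⟨ψ, hψ⟩ := IsIso.symm ⟨φ, hφ⟩
  let e := fun i => LinearEquiv.ofBijective (φ.app i) (hφ i)
  refine ⟨⟨fun i => (e i).symm.toLinearMap ∘ₗ ι.app i, fun i v => ?_⟩, p.comp φ,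
    fun i => ⟨?_, ?_, ?_⟩⟩
  · apply (e (i + 1)).injective
    have h1 := φ.comm i ((e i).symm (ι.app i v))
    have h2 : φ.app i ((e i).symm (ι.app i v)) = ι.app i v := (e i).apply_symm_apply _
    rw [h2] at h1
    simp only [LinearMap.comp_apply, LinearEquiv.coe_coe, LinearEquiv.apply_symm_apply, ι.comm]
    exact h1.symm
  · exact (e i).symm.injective.comp (h i).1
  · intro y
    have h1 := (h i).2.1 (φ.app i y)
    refine h1.trans ⟨?_, ?_⟩
    · rintro ⟨v, hv⟩
      exact ⟨v, (e i).symm_apply_eq.2 hv⟩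
    · rintro ⟨v, hv⟩
      exact ⟨v, (e i).symm_apply_eq.1 hv⟩
  · exact (h i).2.2.comp (hφ i).2

theorem IsExtension.of_isIso_left {E M N N' : Rep k n} (h : IsExtension E M N) (e : IsIso N' N) :
    IsExtension E M N' := by
  obtain ⟨ι, p, h⟩ := h
  obtain ⟨φ, hφ⟩ := e
  refine ⟨ι.comp φ, p, fun i => ⟨(h i).1.comp (hφ i).1, fun y => ((h i).2.1 y).trans ?_, (h i).2.2⟩⟩
  exact ((hφ i).2.exists (p := fun x => ι.app i x = y))

/-- A representation with a finite filtration whose terms are moved one step down by every arrow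
is nilpotent. -/
theorem isNilp_of_filtration [NeZero n] (M : Rep k n) (F : ℕ → ∀ j, Submodule k (M.V j)) (l : ℕ)
    (h0 : ∀ j, F 0 j = ⊤) (hl : ∀ a j, l ≤ a → F a j = ⊥)
    (hF : ∀ a j v, v ∈ F a j → M.map j v ∈ F (a + 1) (j + 1)) : M.IsNilp := by
  have htr : ∀ a {i j : ZMod n} (h : i = j) v, v ∈ F a i → M.transport h v ∈ F a j := by
    intro a i j h v hv
    subst h; exact hv
  have hpath : ∀ m a i v, v ∈ F a i → M.path i m v ∈ F (a + m) (i + (m : ZMod n)) := by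
    intro m a i v hv
    induction m with
    | zero => exact htr _ _ _ hv
    | succ m ih => exact htr _ _ _ (hF _ _ _ ih)
  have hcyc : ∀ m v, (M.cycle 1 ^ m) v ∈ F (m * n) 1 := by
    intro m v
    induction m with
    | zero => simp [h0]
    | succ m ih =>
      rw [pow_succ', Nat.succ_mul]
      exact htr _ _ _ (hpath n _ _ _ ih)
  refine ⟨l, LinearMap.ext fun v => ?_⟩
  have := hcyc l v
  rw [hl _ _ (Nat.le_mul_of_pos_right l (NeZero.pos n))] at this
  simpa using this

theorem IsNilp.of_isIso {M N : Rep k n} (hN : N.IsNilp) (h : IsIso M N) : M.IsNilp := by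
  obtain ⟨φ, hφ⟩ := h
  have hc : ∀ v, φ.app 1 (M.cycle 1 v) = N.cycle 1 (φ.app 1 v) := by
    intro v
    simp only [cycle, LinearMap.comp_apply, φ.app_transport, φ.app_path]
  have hc' : ∀ m v, φ.app 1 ((M.cycle 1 ^ m) v) = (N.cycle 1 ^ m) (φ.app 1 v) := by
    intro m v
    induction m with
    | zero => rfl
    | succ m ih => simp only [pow_succ', Module.End.mul_apply, hc, ih]
  obtain ⟨m, hm⟩ := hN
  refine ⟨m, LinearMap.ext fun v => (hφ 1).1 ?_⟩
  rw [hc', hm]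
  simp

end Basic

/-! ### Direct sums of the representations `S_v[l]` -/

section Strings

variable {k : Type u} [Field k] {n : ℕ} {A B : Type} [Finite A] [Finite B]

/-- The direct sum of the representations `S_v[l]`, where `(v, l) = L s` for `s` in a finite
type. The length `l` may be `0`. -/
def strings (k : Type u) [Field k] {n : ℕ} {A : Type} [Finite A] (L : A → ZMod n × ℕ) : Rep k n :=
  directSum fun s => indec k (L s).1 (L s).2

/-- The coordinate at the basis vector `e_t` of the summand `s`, extended by `0` to all pairs
`(s, t)` for which there is no such basis vector at the vertex `j`. -/
def coef (L : A → ZMod n × ℕ) (j : ZMod n) (s : A) (t : ℕ) : (strings k L).V j →ₗ[k] k where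
  toFun v := if h : t < (L s).2 ∧ (L s).1 + (t : ZMod n) = j then v s ⟨⟨t, h.1⟩, h.2⟩ else 0
  map_add' v w := by
    split_ifs
    · rfl
    · simp
  map_smul' c v := by
    split_ifs
    · rfl
    · simp

variable {L : A → ZMod n × ℕ} {L' : B → ZMod n × ℕ} {j : ZMod n}

/-- The linear map to the direct sum of the `S_v[l]` with given coordinates. -/
def ofCoef {W : Type u} [AddCommGroup W] [Module k W] (L : A → ZMod n × ℕ) (j : ZMod n)
    (F : A → ℕ → W →ₗ[k] k) : W →ₗ[k] (strings k L).V j where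
  toFun w := fun s t => F s t.1 w
  map_add' v w := by funext s t; exact map_add _ _ _
  map_smul' c v := by funext s t; exact map_smul _ _ _

theorem coef_ofCoef {W : Type u} [AddCommGroup W] [Module k W] (F : A → ℕ → W →ₗ[k] k) (w : W)
    (s : A) (t : ℕ) : coef L j s t (ofCoef L j F w) =
      if t < (L s).2 ∧ (L s).1 + (t : ZMod n) = j then F s t w else 0 := by
  change (if h : _ then _ else _) = _
  split_ifs <;> rfl

theorem coef_eq_zero (v : (strings k L).V j) {s : A} {t : ℕ}
    (h : ¬ (t < (L s).2 ∧ (L s).1 + (t : ZMod n) = j)) : coef L j s t v = 0 := by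
  change (if h : _ then _ else _) = _
  rw [dif_neg h]

theorem strings_ext {v w : (strings k L).V j}
    (h : ∀ s t, t < (L s).2 → (L s).1 + (t : ZMod n) = j → coef L j s t v = coef L j s t w) :
    v = w := by
  funext s ⟨⟨t, ht⟩, hj⟩
  have := h s t ht hj
  change (if h : _ then _ else _) = (if h : _ then _ else _) at this
  rwa [dif_pos ⟨ht, hj⟩, dif_pos ⟨ht, hj⟩] at this

theorem coef_map_zero (v : (strings k L).V j) (s : A) :
    coef L (j + 1) s 0 ((strings k L).map j v) = 0 := by
  change (if h : _ then _ else _) = _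
  split_ifs with h
  · rfl
  · rfl

theorem coef_map_succ (v : (strings k L).V j) (s : A) (t : ℕ) :
    coef L (j + 1) s (t + 1) ((strings k L).map j v) =
      if t + 1 < (L s).2 then coef L j s t v else 0 := by
  change (if h : _ then _ else _) = if _ then (if h : _ then _ else _) else _
  have hj : (L s).1 + ((t + 1 : ℕ) : ZMod n) = j + 1 ↔ (L s).1 + (t : ZMod n) = j := by
    push_cast
    rw [← add_assoc]
    exact add_left_inj 1
  by_cases h : t + 1 < (L s).2
  · by_cases h' : (L s).1 + (t : ZMod n) = j
    · rw [dif_pos ⟨h, hj.2 h'⟩, if_pos h, dif_pos ⟨by omega, h'⟩]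
      rfl
    · rw [dif_neg (fun x => h' (hj.1 x.2)), if_pos h, dif_neg (fun x => h' x.2)]
  · rw [dif_neg (fun x => h x.1), if_neg h]

theorem coef_transport {i : ZMod n} (h : i = j) (v : (strings k L).V i) (s : A) (t : ℕ) :
    coef L j s t ((strings k L).transport h v) = coef L i s t v := by
  subst h; rfl

theorem coef_path (i : ZMod n) (m : ℕ) (v : (strings k L).V i) (s : A) (t : ℕ) :
    coef L (i + (m : ZMod n)) s t ((strings k L).path i m v) =
      if m ≤ t ∧ t < (L s).2 then coef L i s (t - m) v else 0 := by
  induction m generalizing t with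
  | zero =>
    simp only [path, coef_transport, zero_le, true_and, Nat.sub_zero]
    split_ifs with h
    · rfl
    · exact coef_eq_zero _ fun x => h x.1
  | succ m ih =>
    simp only [path, LinearMap.comp_apply, coef_transport]
    cases t with
    | zero => simp [coef_map_zero]
    | succ t =>
      rw [coef_map_succ, ih]
      by_cases h : t + 1 < (L s).2 <;> by_cases h' : m ≤ t <;>
        simp [h, h']
      omega

theorem isNilp_strings [NeZero n] (L : A → ZMod n × ℕ) : (strings k L).IsNilp := by
  obtain ⟨l, hl⟩ := (Set.finite_range fun s => (L s).2).bddAbove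
  have hl : ∀ s, (L s).2 ≤ l := fun s => hl ⟨s, rfl⟩
  refine isNilp_of_filtration _
    (fun a j => ⨅ s, ⨅ t, ⨅ _ : t < a, LinearMap.ker (coef L j s t)) l ?_ ?_ ?_
  · intro j
    simp
  · intro a j ha
    rw [eq_bot_iff]
    intro v hv
    simp only [Submodule.mem_iInf, LinearMap.mem_ker] at hv
    refine (Submodule.mem_bot k).2 (strings_ext fun s t ht _ => ?_)
    rw [hv s t (by have := hl s; omega), map_zero]
  · intro a j v hv
    simp only [Submodule.mem_iInf, LinearMap.mem_ker] at hv ⊢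
    intro s t ht
    cases t with
    | zero => exact coef_map_zero _ _
    | succ t =>
      rw [coef_map_succ, hv s t (by omega), ite_self]

/-- Summands of length `0` do not contribute: a label-preserving bijection between the summands of
positive length gives an isomorphism. -/
theorem isIso_strings_of_equiv (e : {a // (L a).2 ≠ 0} ≃ {b // (L' b).2 ≠ 0})
    (he : ∀ a, L' (e a) = L a) : IsIso (strings k L) (strings k L') := by
  classical
  have he' : ∀ b, L (e.symm b) = L' b := fun b => by rw [← he, e.apply_symm_apply]
  refine ⟨⟨fun j => ofCoef L' j fun b t => if h : (L' b).2 ≠ 0 then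
    coef L j (e.symm ⟨b, h⟩) t else 0, fun j v => ?_⟩, fun j => ⟨?_, ?_⟩⟩
  · refine strings_ext fun b t ht hj => ?_
    have hb : (L' b).2 ≠ 0 := by omega
    have h1 := he' ⟨b, hb⟩
    rw [coef_ofCoef, if_pos ⟨ht, hj⟩, dif_pos hb]
    cases t with
    | zero => rw [coef_map_zero, coef_map_zero]
    | succ t =>
      have hj' : (L' b).1 + (t : ZMod n) = j := by
        push_cast at hj
        rw [← add_assoc] at hj
        exact add_right_cancel hj
      rw [coef_map_succ, coef_map_succ, coef_ofCoef, dif_pos hb, h1, if_pos ht, if_pos ht,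
        if_pos ⟨by omega, hj'⟩]
  · rw [injective_iff_map_eq_zero]
    intro v hv
    refine strings_ext fun a t ht hj => ?_
    have ha : (L a).2 ≠ 0 := by omega
    have h1 := congrArg (coef L' j (e ⟨a, ha⟩) t) hv
    rw [coef_ofCoef, if_pos (by rw [he]; exact ⟨ht, hj⟩), dif_pos (e ⟨a, ha⟩).2] at h1
    simpa using h1
  · intro w
    refine ⟨ofCoef L j (fun a t => if h : (L a).2 ≠ 0 then coef L' j (e ⟨a, h⟩) t else 0) w, ?_⟩
    refine strings_ext fun b t ht hj => ?_
    have hb : (L' b).2 ≠ 0 := by omega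
    have h1 := he' ⟨b, hb⟩
    rw [coef_ofCoef, if_pos ⟨ht, hj⟩, dif_pos hb, coef_ofCoef,
      if_pos (by rw [h1]; exact ⟨ht, hj⟩), dif_pos (by rw [h1]; exact hb)]
    simp

theorem isIso_strings_of_card (h : ∀ x : ZMod n × ℕ, x.2 ≠ 0 →
    Nat.card {a // L a = x} = Nat.card {b // L' b = x}) : IsIso (strings k L) (strings k L') := by
  have h1 : ∀ x : ZMod n × ℕ, Nonempty ({a : {a // (L a).2 ≠ 0} // L a = x} ≃
      {b : {b // (L' b).2 ≠ 0} // L' b = x}) := by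
    intro x
    by_cases hx : x.2 = 0
    · have : IsEmpty {a : {a // (L a).2 ≠ 0} // L a = x} := ⟨fun a => a.1.2 (by rw [a.2, hx])⟩
      have : IsEmpty {b : {b // (L' b).2 ≠ 0} // L' b = x} := ⟨fun a => a.1.2 (by rw [a.2, hx])⟩
      exact ⟨Equiv.equivOfIsEmpty _ _⟩
    · have f := (Finite.card_eq.1 (h x hx)).some
      exact ⟨(Equiv.subtypeSubtypeEquivSubtype (p := fun a => (L a).2 ≠ 0) (q := fun a => L a = x)
          fun ha => by rw [ha]; exact hx).trans
        (f.trans (Equiv.subtypeSubtypeEquivSubtype (p := fun b => (L' b).2 ≠ 0)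
          (q := fun b => L' b = x) fun hb => by rw [hb]; exact hx).symm)⟩
  let f := fun x => (h1 x).some
  exact isIso_strings_of_equiv (Equiv.ofFiberEquiv f) fun a => Equiv.ofFiberEquiv_map
    (f := fun a : {a // (L a).2 ≠ 0} => L a) (g := fun b : {b // (L' b).2 ≠ 0} => L' b) f a

end Strings

end Rep

/-! ### Columns of Young diagrams and labels of summands -/

section Labels

theorem Part.lt_dual_iff (p : Part) (m j : ℕ) : m < p.dual.parts j ↔ j < p.parts m := by
  classical
  obtain ⟨N, hN⟩ := p.finite
  have hex : ∃ N, p.parts N ≤ j := ⟨N, by rw [hN N le_rfl]; exact Nat.zero_le j⟩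
  have hset : {m | j < p.parts m} = Set.Iio (Nat.find hex) := by
    ext m
    simp only [Set.mem_ofPred_eq, Set.mem_Iio, Nat.lt_find_iff]
    constructor
    · intro h a ha
      have := p.antitone ha
      omega
    · intro h
      exact not_le.1 (h m le_rfl)
  have hcard : p.dual.parts j = Nat.find hex := by
    change {m | j < p.parts m}.ncard = _
    rw [hset, ← Finset.coe_Iio, Set.ncard_coe_finset, Nat.card_Iio]
  rw [hcard]
  exact (Set.ext_iff.mp hset m).symm

/-- The number of columns of length `c + 1`. -/
theorem Part.card_dual_eq (p : Part) (c : ℕ) :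
    Nat.card {s : Fin (p.parts 0) // p.dual.parts s = c + 1} = p.parts c - p.parts (c + 1) := by
  have key : ∀ s : ℕ, p.dual.parts s = c + 1 ↔ s ∈ Finset.Ico (p.parts (c + 1)) (p.parts c) := by
    intro s
    have h1 := p.lt_dual_iff c s
    have h2 := p.lt_dual_iff (c + 1) s
    rw [Finset.mem_Ico]
    omega
  have e : {s : Fin (p.parts 0) // p.dual.parts s = c + 1} ≃
      Finset.Ico (p.parts (c + 1)) (p.parts c) :=
    { toFun := fun s => ⟨s.1, (key _).1 s.2⟩
      invFun := fun s => ⟨⟨s.1, lt_of_lt_of_le (Finset.mem_Ico.1 s.2).2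
        (p.antitone (Nat.zero_le c))⟩, (key _).2 s.2⟩
      left_inv := fun s => rfl
      right_inv := fun s => rfl }
  rw [Nat.card_congr e, Nat.card_eq_fintype_card, Fintype.card_coe, Nat.card_Ico]

/-- The labels (vertex of the top, length) of the indecomposable summands of `M(π)`. -/
noncomputable def label {n : ℕ} (π : MultiPart n) (s : Σ i : ZMod n, Fin ((π i).parts 0)) :
    ZMod n × ℕ :=
  (s.1, (π s.1).dual.parts s.2)

theorem card_label_eq {n : ℕ} (π : MultiPart n) (j : ZMod n) (c : ℕ) :
    Nat.card {s // label π s = (j, c + 1)} = (π j).parts c - (π j).parts (c + 1) := by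
  rw [← Part.card_dual_eq]
  refine (Nat.card_eq_of_bijective (fun s => ⟨⟨j, s.1⟩, by rw [label, s.2]⟩) ⟨?_, ?_⟩).symm
  · intro s t h
    simpa [Subtype.ext_iff] using h
  · rintro ⟨⟨j', s⟩, h⟩
    obtain ⟨h1, h2⟩ := Prod.mk.inj h
    change j' = j at h1
    subst h1
    exact ⟨⟨s, h2⟩, rfl⟩

/-- The labels of the summands of `M(π)`, together with one summand `S_v[0] = 0`, so that
there is always a label with vertex `v`. -/
noncomputable def labelZero {n : ℕ} (π : MultiPart n) (v : ZMod n) :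
    Option (Σ i : ZMod n, Fin ((π i).parts 0)) → ZMod n × ℕ
  | none => (v, 0)
  | some s => label π s

theorem card_labelZero_eq {n : ℕ} (π : MultiPart n) (v j : ZMod n) (c : ℕ) :
    Nat.card {s // labelZero π v s = (j, c + 1)} = (π j).parts c - (π j).parts (c + 1) := by
  rw [← card_label_eq]
  refine (Nat.card_eq_of_bijective (fun s => ⟨some s.1, s.2⟩) ⟨?_, ?_⟩).symm
  · intro s t h
    simpa [Subtype.ext_iff] using h
  · rintro ⟨_ | s, h⟩
    · exact absurd (Prod.mk.inj h).2 (by omega)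
    · exact ⟨⟨s, h⟩, rfl⟩

theorem card_update_eq {A C : Type*} [Finite A] [DecidableEq A] [DecidableEq C] (L : A → C)
    (s : A) (x y : C) : Nat.card {a // Function.update L s x a = y} + (if L s = y then 1 else 0) =
      Nat.card {a // L a = y} + if x = y then 1 else 0 := by
  have := Fintype.ofFinite A
  have h : ∀ K : A → C, Nat.card {a // K a = y} =
      (if K s = y then 1 else 0) + ∑ a ∈ Finset.univ.erase s, if K a = y then 1 else 0 := by
    intro K
    rw [Nat.card_eq_fintype_card, Fintype.card_subtype, Finset.card_filter]
    exact (Finset.add_sum_erase _ (fun a => if K a = y then 1 else 0) (Finset.mem_univ s)).symm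
  rw [h, h, Function.update_self, Finset.sum_congr rfl fun a ha => by
    rw [Function.update_of_ne (Finset.ne_of_mem_erase ha)]]
  omega

/-- The labels of `M(σ_i⁺ π)` of positive length are those of `M(π)`, except that one label
`(i + 1, l)` with `l` maximal becomes `(i, l + 1)`. -/
theorem card_label_sigmaPlus {n : ℕ} [NeZero n] (hn : 2 ≤ n) (i : ZMod n) (π : MultiPart n)
    (s : Option (Σ i : ZMod n, Fin ((π i).parts 0)))
    (hs : labelZero π (i + 1) s = (i + 1, (π (i + 1)).dual.parts 0)) (x : ZMod n × ℕ)
    (hx : x.2 ≠ 0) :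
    Nat.card {a // label (sigmaPlus i π) a = x} =
      Nat.card {a // Function.update (labelZero π (i + 1)) s
        (i, (π (i + 1)).dual.parts 0 + 1) a = x} := by
  have hi : i + 1 ≠ i := by
    have : Fact (1 < n) := ⟨hn⟩
    simp
  obtain ⟨j, c⟩ := x
  obtain ⟨c, rfl⟩ := Nat.exists_eq_succ_of_ne_zero hx
  have h := card_update_eq (labelZero π (i + 1)) s (i, (π (i + 1)).dual.parts 0 + 1) (j, c + 1)
  rw [card_labelZero_eq, hs] at h
  rw [Nat.succ_eq_add_one, card_label_eq]
  simp only [Prod.mk.injEq] at h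
  have ha : (π j).parts (c + 1) ≤ (π j).parts c := (π j).antitone (Nat.le_succ c)
  by_cases h1 : j = i
  · subst h1
    simp only [hi, false_and, if_false, true_and] at h
    simp only [sigmaPlus, if_true, Part.addOnes, ones]
    split_ifs at h ⊢ <;> omega
  · by_cases h2 : j = i + 1
    · subst h2
      simp only [hi.symm, false_and, if_false, true_and] at h
      simp only [sigmaPlus, if_neg hi, if_true, Part.subOnes, ones]
      have h3 := (π (i + 1)).lt_dual_zero_iff c
      have h4 := (π (i + 1)).lt_dual_zero_iff (c + 1)
      split_ifs at h ⊢ <;> omega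
    · simp only [Ne.symm h1, Ne.symm h2, false_and, if_false] at h
      simp only [sigmaPlus, if_neg h1, if_neg h2]
      omega

end Labels

/-! ### Extensions by a simple representation -/

namespace Rep

section Extensions

variable {k : Type u} [Field k] {n : ℕ}

/-- The extension of `M` by `N` with underlying spaces `N_j × M_j` and cocycle `θ`: the arrow at
`j` maps `(y, z)` to `(f y + θ_j z, f z)`. -/
def ext (N M : Rep k n) (θ : ∀ j, M.V j →ₗ[k] N.V (j + 1)) : Rep k n where
  V j := N.V j × M.V j
  map j := LinearMap.prod (N.map j ∘ₗ LinearMap.fst k _ _ + θ j ∘ₗ LinearMap.snd k _ _)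
    (M.map j ∘ₗ LinearMap.snd k _ _)

variable {N M : Rep k n}

/-- The inclusion of the subrepresentation. -/
def extInl (θ : ∀ j, M.V j →ₗ[k] N.V (j + 1)) : Hom N (ext N M θ) where
  app j := LinearMap.inl k _ _
  comm j v := by
    change (N.map j v, (0 : M.V (j + 1))) = (N.map j v + θ j 0, M.map j 0)
    simp

theorem isExtension_ext (θ : ∀ j, M.V j →ₗ[k] N.V (j + 1)) : IsExtension (ext N M θ) M N :=
  ⟨extInl θ, ⟨fun _ => LinearMap.snd k _ _, fun _ _ => rfl⟩, fun _ =>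
    ⟨LinearMap.inl_injective, Function.Exact.inl_snd, LinearMap.snd_surjective⟩⟩

/-- Linear sections of the projections describe every extension by a cocycle. -/
theorem IsExtension.exists_isIso_ext {E : Rep k n} (h : IsExtension E M N) :
    ∃ θ : ∀ j, M.V j →ₗ[k] N.V (j + 1), IsIso (ext N M θ) E := by
  obtain ⟨ι, p, h⟩ := h
  have hq : ∀ j, ∃ q : M.V j →ₗ[k] E.V j, p.app j ∘ₗ q = LinearMap.id := fun j =>
    (p.app j).exists_rightInverse_of_surjective (LinearMap.range_eq_top.2 (h j).2.2)
  choose q hq using hq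
  have hq' : ∀ j z, p.app j (q j z) = z := fun j z => LinearMap.congr_fun (hq j) z
  have hpι : ∀ j y, p.app j (ι.app j y) = 0 := fun j y => ((h j).2.1 _).2 ⟨y, rfl⟩
  have hδ : ∀ j z, (E.map j ∘ₗ q j - q (j + 1) ∘ₗ M.map j) z ∈ LinearMap.range (ι.app (j + 1)) := by
    intro j z
    refine ((h (j + 1)).2.1 _).1 ?_
    simp [p.comm, hq']
  let θ : ∀ j, M.V j →ₗ[k] N.V (j + 1) := fun j =>
    (LinearEquiv.ofInjective (ι.app (j + 1)) (h (j + 1)).1).symm.toLinearMap ∘ₗ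
      LinearMap.codRestrict _ _ (hδ j)
  have hθ : ∀ j z, ι.app (j + 1) (θ j z) = E.map j (q j z) - q (j + 1) (M.map j z) := by
    intro j z
    have := LinearEquiv.apply_symm_apply (LinearEquiv.ofInjective (ι.app (j + 1)) (h (j + 1)).1)
      (LinearMap.codRestrict _ _ (hδ j) z)
    exact congrArg Subtype.val this
  refine ⟨θ, ⟨fun j => LinearMap.coprod (ι.app j) (q j), ?_⟩, fun j => ⟨?_, ?_⟩⟩
  · rintro j ⟨y, z⟩
    change ι.app (j + 1) (N.map j y + θ j z) + q (j + 1) (M.map j z) =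
      E.map j (ι.app j y + q j z)
    rw [map_add, map_add, hθ, ι.comm]
    abel
  · rw [injective_iff_map_eq_zero]
    rintro ⟨y, z⟩ hyz
    change ι.app j y + q j z = 0 at hyz
    have h1 := congrArg (p.app j) hyz
    rw [map_add, hpι, hq', zero_add, map_zero] at h1
    subst h1
    rw [map_zero, add_zero] at hyz
    rw [(injective_iff_map_eq_zero _).1 (h j).1 y hyz]
    rfl
  · intro x
    obtain ⟨y, hy⟩ := ((h j).2.1 (x - q j (p.app j x))).1 (by simp [hq'])
    refine ⟨(y, p.app j x), ?_⟩
    change ι.app j y + q j (p.app j x) = x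
    rw [hy, sub_add_cancel]

/-- Cocycles that agree up to an automorphism of `N` and a coboundary define isomorphic
extensions. -/
theorem isIso_ext (hM : ∀ j z, M.map j z = 0) {θ θ' : ∀ j, M.V j →ₗ[k] N.V (j + 1)} (α : Hom N N)
    (hα : ∀ j, Function.Bijective (α.app j)) (ν : ∀ j, M.V j →ₗ[k] N.V j)
    (h : ∀ j z, α.app (j + 1) (θ j z) = N.map j (ν j z) + θ' j z) :
    IsIso (ext N M θ) (ext N M θ') := by
  refine ⟨⟨fun j => LinearMap.prod (α.app j ∘ₗ LinearMap.fst k _ _ + ν j ∘ₗ LinearMap.snd k _ _)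
    (LinearMap.snd k _ _), ?_⟩, fun j => ⟨?_, ?_⟩⟩
  · rintro j ⟨y, z⟩
    change (α.app (j + 1) (N.map j y + θ j z) + ν (j + 1) (M.map j z), M.map j z) =
      (N.map j (α.app j y + ν j z) + θ' j z, M.map j z)
    rw [hM, map_add, map_add, h, α.comm, map_zero, add_zero, add_assoc]
  · rw [injective_iff_map_eq_zero]
    rintro ⟨y, z⟩ hyz
    change (α.app j y + ν j z, z) = (0, 0) at hyz
    obtain ⟨h1, rfl⟩ := Prod.mk.inj hyz
    rw [map_zero, add_zero] at h1
    rw [(injective_iff_map_eq_zero _).1 (hα j).1 y h1]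
    rfl
  · rintro ⟨y, z⟩
    obtain ⟨y', hy'⟩ := (hα j).2 (y - ν j z)
    refine ⟨(y', z), ?_⟩
    change (α.app j y' + ν j z, z) = (y, z)
    rw [hy', sub_add_cancel]

theorem transport_map (M : Rep k n) {i j : ZMod n} (h : i = j) (v : M.V i) :
    M.map j (M.transport h v) = M.transport (congrArg (· + 1) h) (M.map i v) := by
  subst h; rfl

theorem transport_transport (M : Rep k n) {i j l : ZMod n} (h : i = j) (h' : j = l) (v : M.V i) :
    M.transport h' (M.transport h v) = M.transport (h.trans h') v := by
  subst h; subst h'; rfl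

theorem path_one (M : Rep k n) (i : ZMod n) (v : M.V i) :
    M.path i 1 v = M.transport (by simp) (M.map i v) := by
  simp only [path, LinearMap.comp_apply, transport_map, transport_transport]

theorem fst_transport_ext (θ : ∀ j, M.V j →ₗ[k] N.V (j + 1)) {i j : ZMod n} (h : i = j)
    (x : (ext N M θ).V i) : ((ext N M θ).transport h x).1 = N.transport h x.1 := by
  subst h; rfl

theorem snd_transport_ext (θ : ∀ j, M.V j →ₗ[k] N.V (j + 1)) {i j : ZMod n} (h : i = j)
    (x : (ext N M θ).V i) : ((ext N M θ).transport h x).2 = M.transport h x.2 := by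
  subst h; rfl

end Extensions

section Simple

variable {k : Type u} [Field k] {n : ℕ} {i : ZMod n}

theorem simple_map (j : ZMod n) (z : (simple k i).V j) : (simple k i).map j z = 0 := by
  funext ⟨⟨t, ht⟩, h⟩
  obtain rfl : t = 0 := by omega
  rfl

/-- The coordinate on `S_i`. -/
def simpleCoord (k : Type u) [Field k] {n : ℕ} (i j : ZMod n) : (simple k i).V j →ₗ[k] k where
  toFun z := if h : i = j then z ⟨0, by simpa using h⟩ else 0
  map_add' v w := by
    split_ifs
    · rfl
    · simp
  map_smul' c v := by
    split_ifs
    · rfl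
    · simp

/-- The basis vector of `S_i` (at the vertex `i`). -/
def simpleGen (k : Type u) [Field k] {n : ℕ} (i j : ZMod n) : (simple k i).V j := fun _ => 1

theorem simpleCoord_of_ne {j : ZMod n} (h : i ≠ j) (z : (simple k i).V j) :
    simpleCoord k i j z = 0 := dif_neg h

theorem simpleCoord_gen : simpleCoord k i i (simpleGen k i i) = 1 := dif_pos rfl

theorem simple_eq (j : ZMod n) (z : (simple k i).V j) :
    z = simpleCoord k i j z • simpleGen k i j := by
  funext ⟨⟨t, ht⟩, h⟩
  obtain rfl : t = 0 := by omega
  have hij : i = j := by simpa using h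
  have h1 : simpleCoord k i j z = z ⟨⟨0, ht⟩, h⟩ := dif_pos hij
  rw [h1]
  exact (mul_one _).symm

end Simple

section SimpleTop

variable {k : Type u} [Field k] {n : ℕ} {i : ZMod n} {A : Type} [Finite A]
  {L : A → ZMod n × ℕ} {j : ZMod n}

/-- The linear map that shifts every basis vector `e_t` back to `e_{t-1}` and kills `e_0`. -/
def unshift (L : A → ZMod n × ℕ) (j : ZMod n) : (strings k L).V (j + 1) →ₗ[k] (strings k L).V j :=
  ofCoef L j fun s t => coef L (j + 1) s (t + 1)

theorem coef_unshift (w : (strings k L).V (j + 1)) (s : A) (t : ℕ) :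
    coef L j s t (unshift L j w) = coef L (j + 1) s (t + 1) w := by
  rw [unshift, coef_ofCoef]
  split_ifs with h
  · rfl
  · refine (coef_eq_zero _ fun h' => h ⟨by omega, ?_⟩).symm
    have := h'.2
    push_cast at this
    rw [← add_assoc] at this
    exact add_right_cancel this

theorem map_unshift (w : (strings k L).V (j + 1)) (h : ∀ s, coef L (j + 1) s 0 w = 0) :
    (strings k L).map j (unshift L j w) = w := by
  refine strings_ext fun s t ht _ => ?_
  cases t with
  | zero => rw [coef_map_zero, h]
  | succ t => rw [coef_map_succ, coef_unshift, if_pos ht]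

/-- The coefficient of a cocycle, i.e. of a class in `Ext¹(S_i, ⨁ S_v[l])`, at the top of the
summand `s`. -/
def topCoef (θ : ∀ j, (simple k i).V j →ₗ[k] (strings k L).V (j + 1)) (s : A) : k :=
  coef L (i + 1) s 0 (θ i (simpleGen k i i))

theorem coef_cocycle (θ : ∀ j, (simple k i).V j →ₗ[k] (strings k L).V (j + 1)) (s : A)
    (z : (simple k i).V j) : coef L (j + 1) s 0 (θ j z) = simpleCoord k i j z * topCoef θ s := by
  by_cases h : i = j
  · subst h
    conv_lhs => rw [simple_eq _ z]
    rw [map_smul, map_smul, smul_eq_mul, topCoef]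
  · have hz := simple_eq _ z
    rw [simpleCoord_of_ne h, zero_smul] at hz
    rw [hz]
    simp

theorem path_ext (θ : ∀ j, (simple k i).V j →ₗ[k] (strings k L).V (j + 1)) (m : ℕ)
    (x : (ext (strings k L) (simple k i) θ).V j) :
    ((ext (strings k L) (simple k i) θ).path j (m + 1) x).2 = 0 ∧
    ∀ s t, coef L (j + ((m + 1 : ℕ) : ZMod n)) s t
      ((ext (strings k L) (simple k i) θ).path j (m + 1) x).1 = if t < (L s).2 then
        (if m + 1 ≤ t then coef L j s (t - (m + 1)) x.1 else 0) +
          (if m ≤ t then coef L (j + 1) s (t - m) (θ j x.2) else 0) else 0 := by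
  induction m with
  | zero =>
    rw [path_one, snd_transport_ext, fst_transport_ext]
    constructor
    · change (simple k i).transport _ ((simple k i).map j x.2) = 0
      rw [simple_map, map_zero]
    · intro s t
      rw [coef_transport]
      change coef L (j + 1) s t ((strings k L).map j x.1 + θ j x.2) = _
      split_ifs with h1 h2 h3 h3
      · obtain ⟨t, rfl⟩ := Nat.exists_eq_add_of_le' h2
        rw [map_add, coef_map_succ, if_pos h1]
        rfl
      · omega
      · obtain rfl : t = 0 := by omega
        rw [map_add, coef_map_zero]
      · omega
      · exact coef_eq_zero _ fun h => h1 h.1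
  | succ m ih =>
    rw [path, LinearMap.comp_apply, LinearMap.comp_apply, snd_transport_ext, fst_transport_ext]
    set p := (ext (strings k L) (simple k i) θ).path j (m + 1) x
    constructor
    · change (simple k i).transport _ ((simple k i).map _ p.2) = 0
      rw [simple_map, map_zero]
    · intro s t
      rw [coef_transport]
      change coef L _ s t ((strings k L).map _ p.1 + θ _ p.2) = _
      rw [ih.1, map_zero, add_zero]
      cases t with
      | zero => simp [coef_map_zero]
      | succ t =>
        rw [coef_map_succ, ih.2]
        by_cases h : t + 1 < (L s).2
        · simp [h, show t < (L s).2 by omega]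
        · simp [h]

variable [DecidableEq A]

/-- The cocycle that maps the generator of `S_i` to the top of the summand `s`. -/
def topCocycle (L : A → ZMod n × ℕ) (i : ZMod n) (s : A) (j : ZMod n) :
    (simple k i).V j →ₗ[k] (strings k L).V (j + 1) :=
  ofCoef L (j + 1) fun a t => if a = s ∧ t = 0 then simpleCoord k i j else 0

theorem topCoef_topCocycle {s : A} {l : ℕ} (hs : L s = (i + 1, l + 1)) (a : A) :
    topCoef (k := k) (topCocycle L i s) a = if a = s then 1 else 0 := by
  rw [topCoef, topCocycle, coef_ofCoef]
  by_cases h : a = s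
  · subst h
    simp [hs, simpleCoord_gen]
  · simp [h]

/-- If the class of an extension has a non-zero coefficient at the summand `s` and all its other
non-zero coefficients sit at summands that are not longer, then an automorphism of the
subrepresentation moves the class to the top of `s`. -/
theorem isIso_ext_topCocycle (θ : ∀ j, (simple k i).V j →ₗ[k] (strings k L).V (j + 1)) (s : A)
    (c : A → k) (hcs : c s ≠ 0) (hc : ∀ a, c a ≠ 0 → (L a).2 ≤ (L s).2)
    (hθ : ∀ a, 0 < (L a).2 → topCoef θ a = c a) :
    IsIso (ext (strings k L) (simple k i) θ)
      (ext (strings k L) (simple k i) (topCocycle L i s)) := by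
  -- The automorphism scales the summand `s` and subtracts multiples of it from the others. It
  -- commutes with the arrows because only summands that are not longer than `s` are changed.
  let α : Hom (strings k L) (strings k L) :=
    { app := fun j => ofCoef L j fun a t => if a = s then (c s)⁻¹ • coef L j s t else
        coef L j a t - (c a * (c s)⁻¹) • coef L j s t
      comm := by
        intro j v
        refine strings_ext fun a t ht hj => ?_
        rw [coef_ofCoef, if_pos ⟨ht, hj⟩]
        cases t with
        | zero =>
          rw [coef_map_zero]
          split_ifs <;> simp [coef_map_zero]
        | succ t =>
          have hj' : (L a).1 + (t : ZMod n) = j := by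
            push_cast at hj
            rw [← add_assoc] at hj
            exact add_right_cancel hj
          rw [coef_map_succ, if_pos ht, coef_ofCoef,
            if_pos (show t < (L a).2 ∧ (L a).1 + (t : ZMod n) = j from ⟨by omega, hj'⟩)]
          split_ifs with has
          · subst has
            simp [coef_map_succ, ht]
          · by_cases hca : c a = 0
            · simp [coef_map_succ, ht, hca]
            · have := hc a hca
              simp [coef_map_succ, ht, show t + 1 < (L s).2 by omega] }
  have hα : ∀ j v a t, t < (L a).2 → (L a).1 + (t : ZMod n) = j → coef L j a t (α.app j v) =
      if a = s then (c s)⁻¹ * coef L j s t v else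
        coef L j a t v - (c a * (c s)⁻¹) * coef L j s t v := by
    intro j v a t ht hj
    change coef L j a t (ofCoef L j _ v) = _
    rw [coef_ofCoef, if_pos ⟨ht, hj⟩]
    split_ifs <;> rfl
  have hinj : ∀ j, Function.Injective (α.app j) := by
    intro j
    rw [injective_iff_map_eq_zero]
    intro v hv
    have hs : ∀ t, coef L j s t v = 0 := by
      intro t
      by_cases hst : t < (L s).2 ∧ (L s).1 + (t : ZMod n) = j
      · have h1 := hα j v s t hst.1 hst.2
        rw [hv, map_zero, if_pos rfl] at h1
        simpa [hcs] using h1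
      · exact coef_eq_zero _ hst
    refine strings_ext fun a t ht hj => ?_
    have h1 := hα j v a t ht hj
    rw [hv, map_zero, hs] at h1
    rw [map_zero]
    split_ifs at h1 with has
    · rw [has, hs]
    · simpa using h1.symm
  refine isIso_ext simple_map α
    (fun j => ⟨hinj j, LinearMap.injective_iff_surjective.1 (hinj j)⟩)
    (fun j => unshift L j ∘ₗ (α.app (j + 1) ∘ₗ θ j - topCocycle L i s j)) fun j z => ?_
  rw [LinearMap.comp_apply, map_unshift]
  · simp
  · intro a
    by_cases ha : 0 < (L a).2 ∧ (L a).1 + ((0 : ℕ) : ZMod n) = j + 1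
    · rw [LinearMap.sub_apply, map_sub, LinearMap.comp_apply, hα _ _ _ _ ha.1 ha.2, topCocycle,
        coef_ofCoef, if_pos ha, coef_cocycle, coef_cocycle, hθ a ha.1]
      split_ifs with h1 h2 h2
      · subst h1
        rw [hθ a ha.1]
        field_simp
        simp
      · exact absurd ⟨h1, rfl⟩ h2
      · exact absurd h2.1 h1
      · rw [LinearMap.zero_apply, sub_zero]
        by_cases hca : c a = 0
        · simp [hca]
        · rw [hθ s (lt_of_lt_of_le ha.1 (hc a hca))]
          field_simp
          simp
    · exact coef_eq_zero _ ha

/-- The extension of `S_i` by the top of a summand `S_{i+1}[l]` replaces this summand by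
`S_i[l+1]`. -/
theorem isIso_ext_strings_update {s : A} (hs : (L s).1 = i + 1) :
    IsIso (ext (strings k L) (simple k i) (topCocycle L i s))
      (strings k (Function.update L s (i, (L s).2 + 1))) := by
  set L' := Function.update L s (i, (L s).2 + 1) with hL'
  have hs' : L' s = (i, (L s).2 + 1) := Function.update_self _ _ _
  have ha' : ∀ a, a ≠ s → L' a = L a := fun a h => Function.update_of_ne h _ _
  let Φ : ∀ j, (strings k L).V j × (simple k i).V j →ₗ[k] (strings k L').V j :=
    fun j => ofCoef L' j fun a t =>
      if a = s then
        if t = 0 then simpleCoord k i j ∘ₗ LinearMap.snd k _ _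
        else coef L j s (t - 1) ∘ₗ LinearMap.fst k _ _
      else coef L j a t ∘ₗ LinearMap.fst k _ _
  have hΦ0 : ∀ j y z, coef L' j s 0 (Φ j (y, z)) = simpleCoord k i j z := by
    intro j y z
    rw [coef_ofCoef, hs', if_pos rfl, if_pos rfl]
    split_ifs with h
    · rfl
    · exact (simpleCoord_of_ne (fun h' => h ⟨Nat.succ_pos _, by simpa using h'⟩) z).symm
  have hshift : ∀ (j : ZMod n) (t : ℕ), i + ((t + 1 : ℕ) : ZMod n) = j ↔
      (L s).1 + (t : ZMod n) = j := by
    intro j t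
    rw [hs]
    push_cast
    rw [add_assoc, add_comm (1 : ZMod n)]
  have hΦ1 : ∀ j y z t, coef L' j s (t + 1) (Φ j (y, z)) = coef L j s t y := by
    intro j y z t
    rw [coef_ofCoef, hs', if_pos rfl, if_neg (Nat.succ_ne_zero t)]
    split_ifs with h
    · rfl
    · exact (coef_eq_zero y fun h' => h ⟨by simpa using h'.1, (hshift j t).2 h'.2⟩).symm
  have hΦ2 : ∀ j y z a t, a ≠ s → coef L' j a t (Φ j (y, z)) = coef L j a t y := by
    intro j y z a t h
    rw [coef_ofCoef, ha' a h, if_neg h]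
    split_ifs with h'
    · rfl
    · exact (coef_eq_zero y h').symm
  refine ⟨⟨Φ, ?_⟩, fun j => ⟨?_, ?_⟩⟩
  · rintro j ⟨y, z⟩
    change Φ (j + 1) ((strings k L).map j y + topCocycle L i s j z, (simple k i).map j z) =
      (strings k L').map j (Φ j (y, z))
    refine strings_ext fun a t ht hj => ?_
    by_cases h : a = s
    · subst h
      rw [hs'] at ht hj
      cases t with
      | zero => rw [hΦ0, simple_map, map_zero, coef_map_zero]
      | succ t =>
        simp only at ht hj
        rw [hshift] at hj
        rw [hΦ1, map_add, coef_map_succ, hs', if_pos ht, topCocycle, coef_ofCoef,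
          if_pos ⟨by omega, hj⟩]
        cases t with
        | zero =>
          rw [coef_map_zero, hΦ0]
          simp
        | succ t =>
          rw [coef_map_succ, hΦ1, if_pos (by omega)]
          simp
    · rw [ha' a h] at ht hj
      rw [hΦ2 _ _ _ _ _ h, map_add, topCocycle, coef_ofCoef, if_pos ⟨ht, hj⟩]
      cases t with
      | zero => simp [coef_map_zero, h]
      | succ t => simp [coef_map_succ, ha' a h, hΦ2 j y z a t h, h, ht]
  · rw [injective_iff_map_eq_zero]
    rintro ⟨y, z⟩ h
    change Φ j (y, z) = 0 at h
    have hy : y = 0 := by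
      refine strings_ext fun a t _ _ => ?_
      by_cases ha : a = s
      · subst ha
        rw [← hΦ1 j y z, h, map_zero, map_zero]
      · rw [← hΦ2 j y z a t ha, h, map_zero, map_zero]
    have hz : z = 0 := by
      rw [simple_eq _ z, ← hΦ0 j y z, h, map_zero, zero_smul]
    rw [hy, hz]
    rfl
  · intro x
    let y : (strings k L).V j := ofCoef L j (fun a t =>
      if a = s then coef L' j s (t + 1) else coef L' j a t) x
    refine ⟨(y, coef L' j s 0 x • simpleGen k i j), strings_ext fun a t ht hj => ?_⟩
    change coef L' j a t (Φ j (y, coef L' j s 0 x • simpleGen k i j)) = _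
    by_cases h : a = s
    · subst h
      rw [hs'] at ht hj
      cases t with
      | zero =>
        obtain rfl : i = j := by simpa using hj
        rw [hΦ0, map_smul, simpleCoord_gen, smul_eq_mul, mul_one]
      | succ t =>
        simp only at ht hj
        rw [hΦ1, coef_ofCoef, if_pos ⟨by omega, (hshift j t).1 hj⟩, if_pos rfl]
    · rw [ha' a h] at ht hj
      rw [hΦ2 _ _ _ _ _ h, coef_ofCoef, if_pos ⟨ht, hj⟩, if_neg h]

end SimpleTop

/-! ### Ranks of paths in extensions -/

section Rank

variable {k : Type u} [Field k] {n : ℕ} {i : ZMod n} {A : Type} [Finite A]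
  {L : A → ZMod n × ℕ}

theorem pos_and_eq_of_topCoef_ne_zero
    {θ : ∀ j, (simple k i).V j →ₗ[k] (strings k L).V (j + 1)} {s : A} (h : topCoef θ s ≠ 0) :
    0 < (L s).2 ∧ (L s).1 = i + 1 := by
  by_contra h'
  exact h (coef_eq_zero _ (by simpa using h'))

/-- If the class of an extension vanishes at the tops of the longest summands `S_{i+1}[m+1]`, then
the paths of length `m + 1` starting at `i` do not gain rank. -/
theorem pathRank_ext_le (θ : ∀ j, (simple k i).V j →ₗ[k] (strings k L).V (j + 1)) (m : ℕ)
    (hL : ∀ s, (L s).1 = i + 1 → (L s).2 ≤ m + 1)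
    (hθ : ∀ s, L s = (i + 1, m + 1) → topCoef θ s = 0) :
    (ext (strings k L) (simple k i) θ).pathRank i (m + 1) ≤ (strings k L).pathRank i (m + 1) := by
  have hle : LinearMap.range ((ext (strings k L) (simple k i) θ).path i (m + 1)) ≤
      (LinearMap.range ((strings k L).path i (m + 1))).map ((extInl θ).app _) := by
    rintro _ ⟨x, rfl⟩
    obtain ⟨h2, h1⟩ := path_ext θ m x
    refine ⟨(strings k L).path i (m + 1) (x.1 + unshift L i (θ i x.2)), ⟨_, rfl⟩, ?_⟩
    refine Prod.ext (strings_ext fun s t ht _ => ?_) h2.symm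
    rw [h1, if_pos ht]
    change coef L _ s t ((strings k L).path i (m + 1) _) = _
    rw [coef_path]
    by_cases h : m + 1 ≤ t
    · rw [if_pos ⟨h, ht⟩, map_add, coef_unshift, if_pos h, if_pos (by omega),
        show t - (m + 1) + 1 = t - m by omega]
    · rw [if_neg (fun h' => h h'.1), if_neg h, zero_add]
      split_ifs with h'
      · obtain rfl : t = m := by omega
        rw [Nat.sub_self, coef_cocycle]
        -- Only a summand of length exactly `m + 1` has a basis vector `e_m` and is not too long.
        by_cases hs : topCoef θ s = 0
        · rw [hs, mul_zero]
        · have h3 := pos_and_eq_of_topCoef_ne_zero hs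
          refine absurd (hθ s (Prod.ext h3.2 ?_)) hs
          have := hL s h3.2
          simp only
          omega
      · rfl
  exact (Submodule.finrank_mono hle).trans (Submodule.finrank_map_le _ _)

/-- If the class of an extension does not vanish at the top of a summand of length greater than
`m`, then the paths of length `m + 1` starting at `i` gain rank. -/
theorem pathRank_lt_ext (θ : ∀ j, (simple k i).V j →ₗ[k] (strings k L).V (j + 1)) (m : ℕ) (s : A)
    (hs : m < (L s).2) (hθ : topCoef θ s ≠ 0) :
    (strings k L).pathRank i (m + 1) < (ext (strings k L) (simple k i) θ).pathRank i (m + 1) := by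
  have hlt : (LinearMap.range ((strings k L).path i (m + 1))).map ((extInl θ).app _) <
      LinearMap.range ((ext (strings k L) (simple k i) θ).path i (m + 1)) := by
    rw [SetLike.lt_iff_le_and_exists]
    constructor
    · rintro _ ⟨_, ⟨y, rfl⟩, rfl⟩
      exact ⟨(extInl θ).app i y, ((extInl θ).app_path i (m + 1) y).symm⟩
    · let x : (ext (strings k L) (simple k i) θ).V i := ((0 : (strings k L).V i), simpleGen k i i)
      refine ⟨_, ⟨x, rfl⟩, ?_⟩
      rintro ⟨_, ⟨y, rfl⟩, hy⟩
      have h1 := (path_ext θ m x).2 s m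
      rw [← hy] at h1
      change coef L _ s m ((strings k L).path i (m + 1) y) = _ at h1
      rw [coef_path, if_neg (by omega), if_pos hs, if_neg (by omega), if_pos le_rfl, zero_add,
        Nat.sub_self] at h1
      exact hθ h1.symm
  refine lt_of_eq_of_lt ?_ (Submodule.finrank_lt_finrank_of_lt hlt)
  exact (Submodule.equivMapOfInjective ((extInl θ).app (i + ((m + 1 : ℕ) : ZMod n)))
    LinearMap.inl_injective _).finrank_eq

variable [DecidableEq A]

theorem isIso_strings_update {s s' : A} (h : L s = L s') (x : ZMod n × ℕ) :
    IsIso (strings k (Function.update L s x)) (strings k (Function.update L s' x)) := by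
  refine isIso_strings_of_card fun y _ => ?_
  have h1 := card_update_eq L s x y
  have h2 := card_update_eq L s' x y
  rw [h] at h1
  omega

variable {s₀ : A} {l : ℕ}

theorem isIso_ext_of_topCoef_ne_zero (hs₀ : L s₀ = (i + 1, l))
    (hL : ∀ s, (L s).1 = i + 1 → (L s).2 ≤ l)
    (θ : ∀ j, (simple k i).V j →ₗ[k] (strings k L).V (j + 1)) {s : A} (hs : L s = (i + 1, l))
    (hθ : topCoef θ s ≠ 0) :
    IsIso (ext (strings k L) (simple k i) θ)
      (strings k (Function.update L s₀ (i, l + 1))) := by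
  refine (isIso_ext_topCocycle θ s (topCoef θ) hθ (fun a ha => ?_) fun _ _ => rfl).trans
    ((isIso_ext_strings_update (by rw [hs])).trans ?_)
  · rw [hs]
    exact hL a (pos_and_eq_of_topCoef_ne_zero ha).2
  · rw [hs]
    exact isIso_strings_update (hs.trans hs₀.symm) _

/-- If there is no summand of positive length with top `S_{i+1}`, then every extension splits. -/
theorem isIso_ext_of_length_zero (hs₀ : L s₀ = (i + 1, 0))
    (hL : ∀ s, (L s).1 = i + 1 → (L s).2 ≤ 0)
    (θ : ∀ j, (simple k i).V j →ₗ[k] (strings k L).V (j + 1)) :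
    IsIso (ext (strings k L) (simple k i) θ)
      (strings k (Function.update L s₀ (i, 0 + 1))) := by
  have h0 : ∀ a, topCoef θ a = 0 := fun a => by
    by_contra ha
    have h := pos_and_eq_of_topCoef_ne_zero ha
    have := hL a h.2
    omega
  have h1 := isIso_ext_strings_update (k := k) (L := L) (i := i) (s := s₀) (by rw [hs₀])
  rw [hs₀] at h1
  refine (isIso_ext_topCocycle θ s₀ (fun a => if a = s₀ then 1 else 0) (by simp) (fun a ha => ?_)
    fun a ha => ?_).trans h1
  · obtain rfl : a = s₀ := by simpa using ha
    exact le_rfl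
  · rw [h0, if_neg]
    rintro rfl
    simp [hs₀] at ha

/-- An extension of `S_i` is either the generic one or is told apart from it by the rank of a
path. -/
theorem isIso_or_pathRank_lt (hs₀ : L s₀ = (i + 1, l)) (hL : ∀ s, (L s).1 = i + 1 → (L s).2 ≤ l)
    (θ : ∀ j, (simple k i).V j →ₗ[k] (strings k L).V (j + 1)) :
    IsIso (ext (strings k L) (simple k i) θ) (strings k (Function.update L s₀ (i, l + 1))) ∨
      (ext (strings k L) (simple k i) θ).pathRank i l <
        (strings k (Function.update L s₀ (i, l + 1))).pathRank i l := by
  cases l with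
  | zero => exact Or.inl (isIso_ext_of_length_zero hs₀ hL θ)
  | succ m =>
    by_cases h : ∃ s, L s = (i + 1, m + 1) ∧ topCoef θ s ≠ 0
    · obtain ⟨s, hs, hθ⟩ := h
      exact Or.inl (isIso_ext_of_topCoef_ne_zero hs₀ hL θ hs hθ)
    · right
      push Not at h
      refine (pathRank_ext_le θ m hL h).trans_lt ?_
      have h1 := isIso_ext_strings_update (k := k) (L := L) (i := i) (s := s₀) (by rw [hs₀])
      rw [hs₀] at h1
      rw [← h1.pathRank_eq]
      exact pathRank_lt_ext _ m s₀ (by rw [hs₀]; exact Nat.lt_succ_self m)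
        (by rw [topCoef_topCocycle hs₀, if_pos rfl]; exact one_ne_zero)

/-- On the line of cocycles through `θ` in the direction of the top of a longest summand, at most
one extension is not the generic one. -/
theorem exists_forall_isIso_ext (hs₀ : L s₀ = (i + 1, l))
    (hL : ∀ s, (L s).1 = i + 1 → (L s).2 ≤ l)
    (θ : ∀ j, (simple k i).V j →ₗ[k] (strings k L).V (j + 1)) :
    ∃ t₀ : k, ∀ t ≠ t₀, IsIso
      (ext (strings k L) (simple k i) fun j => θ j + t • topCocycle L i s₀ j)
      (strings k (Function.update L s₀ (i, l + 1))) := by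
  cases l with
  | zero => exact ⟨0, fun t _ => isIso_ext_of_length_zero hs₀ hL _⟩
  | succ m =>
    refine ⟨-topCoef θ s₀, fun t ht => isIso_ext_of_topCoef_ne_zero hs₀ hL _ hs₀ ?_⟩
    have h1 : topCoef (fun j => θ j + t • topCocycle L i s₀ j) s₀ =
        topCoef θ s₀ + t * topCoef (k := k) (topCocycle L i s₀) s₀ := by
      simp [topCoef]
    rw [h1, topCoef_topCocycle hs₀, if_pos rfl, mul_one]
    exact fun h => ht (eq_neg_of_add_eq_zero_right h)

end Rank

/-! ### Orbits, their closures and dimensions -/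

section Geometry

variable {k : Type u} [Field k] {n : ℕ} {d : ZMod n → ℕ}

/-- The matrix of the arrow at `j` given by a point of `R(d)`. -/
def pointMatrix (x : Coord d → k) (j : ZMod n) : Matrix (Fin (d (j + 1))) (Fin (d j)) k :=
  Matrix.of fun a b => x ⟨j, a, b⟩

theorem isIso_ofPoint {x y : Coord d → k} (a : ∀ j, Matrix (Fin (d j)) (Fin (d j)) k)
    (ha : ∀ j, (a j).det ≠ 0)
    (h : ∀ j, a (j + 1) * pointMatrix x j = pointMatrix y j * a j) :
    IsIso (ofPoint d x) (ofPoint d y) := by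
  refine ⟨⟨fun j => Matrix.toLin' (a j), fun j (v : Fin (d j) → k) => ?_⟩, fun j => ?_⟩
  · change Matrix.toLin' (a (j + 1)) (Matrix.toLin' (pointMatrix x j) v) =
      Matrix.toLin' (pointMatrix y j) (Matrix.toLin' (a j) v)
    rw [← Matrix.toLin'_mul_apply, ← Matrix.toLin'_mul_apply, h]
  · have hu : IsUnit (LinearMap.det (Matrix.toLin' (a j))) := by
      rw [LinearMap.det_toLin']
      exact (ha j).isUnit
    exact (LinearEquiv.ofIsUnitDet (f := Matrix.toLin' (a j))
      (v := Pi.basisFun k _) (v' := Pi.basisFun k _)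
      (by rwa [← LinearMap.det_toMatrix (Pi.basisFun k _)] at hu)).bijective

theorem exists_matrix_of_isIso {x y : Coord d → k} (h : IsIso (ofPoint d x) (ofPoint d y)) :
    ∃ a : ∀ j, Matrix (Fin (d j)) (Fin (d j)) k, (∀ j, (a j).det ≠ 0) ∧
      ∀ j, a (j + 1) * pointMatrix x j = pointMatrix y j * a j := by
  obtain ⟨φ, hφ⟩ := h
  let f : ∀ j, (Fin (d j) → k) →ₗ[k] (Fin (d j) → k) := fun j => φ.app j
  have hf : ∀ j, Function.Bijective (f j) := hφ
  refine ⟨fun j => LinearMap.toMatrix' (f j), fun j => ?_, fun j => ?_⟩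
  · rw [LinearMap.det_toMatrix']
    exact (LinearEquiv.isUnit_det' (LinearEquiv.ofBijective (f j) (hf j))).ne_zero
  · apply Matrix.toLin'.injective
    refine LinearMap.ext fun v => ?_
    rw [Matrix.toLin'_mul_apply, Matrix.toLin'_mul_apply, Matrix.toLin'_toMatrix',
      Matrix.toLin'_toMatrix']
    exact φ.comm j v

theorem orbit_nonempty (M : Rep k n) : (orbit M.dimVec M).Nonempty := by
  let e : ∀ j, M.V j ≃ₗ[k] (Fin (M.dimVec j) → k) := fun j =>
    (Module.finBasis k (M.V j)).equivFun
  let x : Coord M.dimVec → k := fun c => LinearMap.toMatrix' ((e (c.1 + 1)).toLinearMap ∘ₗ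
    M.map c.1 ∘ₗ (e c.1).symm.toLinearMap) c.2.1 c.2.2
  have hx : ∀ j, pointMatrix x j = LinearMap.toMatrix' ((e (j + 1)).toLinearMap ∘ₗ
    M.map j ∘ₗ (e j).symm.toLinearMap) := fun j => rfl
  have h : IsIso M (ofPoint M.dimVec x) := by
    refine ⟨⟨fun j => (e j).toLinearMap, fun j v => ?_⟩, fun j => (e j).bijective⟩
    change e (j + 1) (M.map j v) = Matrix.toLin' (pointMatrix x j) (e j v)
    rw [hx, Matrix.toLin'_toMatrix']
    simp
  exact ⟨x, h.symm⟩

/-- The representation with the same spaces and the arrows changed by `h`. -/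
def addMap (E : Rep k n) (h : ∀ j, E.V j →ₗ[k] E.V (j + 1)) : Rep k n where
  V := E.V
  map j := E.map j + h j

/-- If all but one of the representations on a line through `E` are isomorphic to `T`, then `E`
is a degeneration of `T`: its orbit lies in the closure of the orbit of `T`. -/
theorem vanishingIdeal_orbit_le [Infinite k] (E T : Rep k n)
    (h : ∀ j, E.V j →ₗ[k] E.V (j + 1)) (t₀ : k)
    (hT : ∀ t ≠ t₀, IsIso (E.addMap fun j => t • h j) T) :
    MvPolynomial.vanishingIdeal k (orbit d T) ≤ MvPolynomial.vanishingIdeal k (orbit d E) := by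
  rintro p hp x ⟨φ, hφ⟩
  let e : ∀ j, (Fin (d j) → k) ≃ₗ[k] E.V j := fun j => LinearEquiv.ofBijective (φ.app j) (hφ j)
  let g : ∀ j, (Fin (d j) → k) →ₗ[k] (Fin (d (j + 1)) → k) := fun j =>
    (e (j + 1)).symm.toLinearMap ∘ₗ h j ∘ₗ (e j).toLinearMap
  let y : Coord d → k := fun c => LinearMap.toMatrix' (g c.1) c.2.1 c.2.2
  have hy : ∀ j, pointMatrix y j = LinearMap.toMatrix' (g j) := fun j => rfl
  have hmem : ∀ t ≠ t₀, x + t • y ∈ orbit d T := by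
    intro t ht
    suffices h0 : IsIso (ofPoint d (x + t • y)) (E.addMap fun j => t • h j) from
      h0.trans (hT t ht)
    refine ⟨⟨fun j => (e j).toLinearMap, fun j (v : Fin (d j) → k) => ?_⟩,
      fun j => (e j).bijective⟩
    have h1 : pointMatrix (x + t • y) j = pointMatrix x j + t • pointMatrix y j := rfl
    have h2 : e (j + 1) (Matrix.toLin' (pointMatrix x j) v) = E.map j (e j v) := φ.comm j v
    change e (j + 1) (Matrix.toLin' (pointMatrix (x + t • y) j) v) =
      E.map j (e j v) + t • h j (e j v)
    rw [h1, map_add, LinearMap.add_apply, map_add, h2, map_smul, hy, Matrix.toLin'_toMatrix']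
    simp [g]
  let q : Polynomial k := MvPolynomial.aeval
    (fun c => Polynomial.C (x c) + Polynomial.X * Polynomial.C (y c)) p
  have hq : ∀ t, q.eval t = MvPolynomial.aeval (x + t • y) p := by
    intro t
    have h1 : (Polynomial.aeval t) q = MvPolynomial.aeval (x + t • y) p := by
      rw [← AlgHom.comp_apply, MvPolynomial.comp_aeval]
      congr 2
      funext c
      simp
      exact mul_comm _ _
    rw [← h1, Polynomial.coe_aeval_eq_eval]
  have hq0 : q = 0 := by
    refine Polynomial.eq_zero_of_infinite_isRoot q (Set.Infinite.mono (s := {t₀}ᶜ) ?_ ?_)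
    · intro t ht
      change q.eval t = 0
      rw [hq]
      exact hp _ (hmem t ht)
    · exact (Set.finite_singleton t₀).infinite_compl
  have h0 := hq 0
  rw [hq0, zero_smul, add_zero, Polynomial.eval_zero] at h0
  exact h0.symm

/-- A polynomial function along a rational curve becomes polynomial after multiplication with a
power of the common denominator `D`. -/
theorem exists_clear_denominator {σ : Type*} (f : MvPolynomial σ k) (D : Polynomial k)
    (N : σ → Polynomial k) : ∃ (F : Polynomial k) (m : ℕ), ∀ t, D.eval t ≠ 0 →
      F.eval t = D.eval t ^ m * MvPolynomial.aeval (fun s => (N s).eval t / D.eval t) f := by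
  induction f using MvPolynomial.induction_on with
  | C a => exact ⟨Polynomial.C a, 0, fun t _ => by simp⟩
  | add p q hp hq =>
    obtain ⟨F, m, hF⟩ := hp
    obtain ⟨F', m', hF'⟩ := hq
    refine ⟨F * D ^ m' + F' * D ^ m, m + m', fun t ht => ?_⟩
    rw [Polynomial.eval_add, Polynomial.eval_mul, Polynomial.eval_mul, Polynomial.eval_pow,
      Polynomial.eval_pow, hF t ht, hF' t ht, map_add]
    ring
  | mul_X p s hp =>
    obtain ⟨F, m, hF⟩ := hp
    refine ⟨F * N s, m + 1, fun t ht => ?_⟩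
    rw [Polynomial.eval_mul, hF t ht, map_mul, MvPolynomial.aeval_X]
    field_simp
    ring

/-- Orbits are irreducible: any two points of an orbit lie on a rational curve whose general
point lies in the orbit. -/
theorem isPrime_vanishingIdeal_orbit [Infinite k] [NeZero n] (T : Rep k n)
    (hne : (orbit d T).Nonempty) : (MvPolynomial.vanishingIdeal k (orbit d T)).IsPrime := by
  refine ⟨?_, ?_⟩
  · obtain ⟨x, hx⟩ := hne
    intro h
    have := (Ideal.eq_top_iff_one _).1 h x hx
    simp at this
  intro f g hfg
  by_contra hcon
  push Not at hcon
  obtain ⟨hf, hg⟩ := hcon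
  simp only [MvPolynomial.mem_vanishingIdeal_iff, not_forall] at hf hg
  obtain ⟨x, hx, hfx⟩ := hf
  obtain ⟨y, hy, hgy⟩ := hg
  obtain ⟨a, ha, hax⟩ := exists_matrix_of_isIso (IsIso.trans hx (IsIso.symm hy))
  -- The curve `c` in `∏ End(k ^ d_j)` joins the identity (at `0`) to `a` (at `1`).
  let c : ∀ j, Matrix (Fin (d j)) (Fin (d j)) (Polynomial k) := fun j =>
    (1 - Polynomial.X : Polynomial k) • 1 + (Polynomial.X : Polynomial k) • (a j).map Polynomial.C
  let D : Polynomial k := ∏ j, (c j).det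
  -- The translate of `x` by `c` has numerators `B` over the common denominator `D`.
  let B : ∀ j, Matrix (Fin (d (j + 1))) (Fin (d j)) (Polynomial k) := fun j =>
    (∏ j' ∈ Finset.univ.erase j, (c j').det) •
      (c (j + 1) * (pointMatrix x j).map Polynomial.C * (c j).adjugate)
  let P : k → Coord d → k := fun t s => (B s.1 s.2.1 s.2.2).eval t / D.eval t
  let ct : k → ∀ j, Matrix (Fin (d j)) (Fin (d j)) k := fun t j => (c j).map (Polynomial.eval t)
  have hct : ∀ t j, ct t j = (1 - t) • 1 + t • a j := by
    intro t j
    ext u v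
    by_cases huv : u = v
    · subst huv
      simp [ct, c]
      exact mul_comm _ _
    · simp [ct, c, huv]
      exact mul_comm _ _
  have hdet : ∀ t j, (ct t j).det = (c j).det.eval t := by
    intro t j
    exact (RingHom.map_det (Polynomial.evalRingHom t) (c j)).symm
  have hD : ∀ t, D.eval t = ∏ j, (ct t j).det := by
    intro t
    simp only [D, Polynomial.eval_prod, hdet]
  have hPB : ∀ t j, D.eval t ≠ 0 →
      pointMatrix (P t) j * ct t j = ct t (j + 1) * pointMatrix x j := by
    intro t j hDt
    have h1 : pointMatrix (P t) j = (D.eval t)⁻¹ • (B j).map (Polynomial.eval t) := by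
      ext u v
      simp [pointMatrix, P, div_eq_inv_mul]
    have h2 : (B j).map (Polynomial.eval t) = (∏ j' ∈ Finset.univ.erase j, (ct t j').det) •
        (ct t (j + 1) * pointMatrix x j * (ct t j).adjugate) := by
      have h3 : (c j).adjugate.map (Polynomial.eval t) = (ct t j).adjugate :=
        RingHom.map_adjugate (Polynomial.evalRingHom t) (c j)
      have h4 : ((pointMatrix x j).map Polynomial.C).map (Polynomial.eval t) =
          pointMatrix x j := by
        ext u v
        simp
      have h5 : (c (j + 1) * (pointMatrix x j).map Polynomial.C * (c j).adjugate).map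
          (Polynomial.evalRingHom t) = ct t (j + 1) * pointMatrix x j * (ct t j).adjugate := by
        rw [Matrix.map_mul, Matrix.map_mul]
        simp only [Polynomial.coe_evalRingHom, h3, h4]
        rfl
      rw [← h5]
      ext u v
      simp [B, Polynomial.eval_prod, hdet]
    rw [h1, h2, smul_smul, Matrix.smul_mul, Matrix.mul_assoc, Matrix.adjugate_mul, Matrix.mul_smul,
      Matrix.mul_one, smul_smul, mul_assoc, mul_comm (∏ j' ∈ _, _),
      Finset.mul_prod_erase _ (fun j' => (ct t j').det) (Finset.mem_univ j), ← hD,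
      inv_mul_cancel₀ hDt, one_smul]
  have hmem : ∀ t, D.eval t ≠ 0 → P t ∈ orbit d T := by
    intro t hDt
    refine IsIso.trans (IsIso.symm (isIso_ofPoint (ct t) (fun j => ?_) fun j => ?_)) hx
    · rw [hD] at hDt
      exact Finset.prod_ne_zero_iff.1 hDt j (Finset.mem_univ j)
    · exact (hPB t j hDt).symm
  have hpt : ∀ {z w : Coord d → k}, (∀ j, pointMatrix z j = pointMatrix w j) → z = w := by
    intro z w h
    funext ⟨j, u, v⟩
    exact congrFun (congrFun (h j) u) v
  have hD0 : D.eval 0 ≠ 0 := by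
    rw [hD]
    simp [hct]
  have hD1 : D.eval 1 ≠ 0 := by
    rw [hD]
    simp [hct, Finset.prod_ne_zero_iff, ha]
  have hP0 : P 0 = x := by
    refine hpt fun j => ?_
    have := hPB 0 j hD0
    simpa [hct] using this
  have hP1 : P 1 = y := by
    refine hpt fun j => ?_
    have h1 := hPB 1 j hD1
    simp only [hct, sub_self, zero_smul, zero_add, one_smul] at h1
    rw [hax] at h1
    have hu : IsUnit (a j).det := (ha j).isUnit
    rw [← Matrix.mul_nonsing_inv_cancel_right (a j) (pointMatrix (P 1) j) hu, h1,
      Matrix.mul_nonsing_inv_cancel_right _ _ hu]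
  obtain ⟨F, m, hF⟩ := exists_clear_denominator f D fun s => B s.1 s.2.1 s.2.2
  obtain ⟨F', m', hF'⟩ := exists_clear_denominator g D fun s => B s.1 s.2.1 s.2.2
  have hzero : F * F' * D = 0 := by
    refine Polynomial.funext fun t => ?_
    rw [Polynomial.eval_zero, Polynomial.eval_mul, Polynomial.eval_mul]
    by_cases hDt : D.eval t = 0
    · rw [hDt, mul_zero]
    · have h1 := hfg (P t) (hmem t hDt)
      rw [map_mul] at h1
      rw [hF t hDt, hF' t hDt]
      change D.eval t ^ m * MvPolynomial.aeval (P t) f *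
        (D.eval t ^ m' * MvPolynomial.aeval (P t) g) * _ = 0
      linear_combination D.eval t ^ m * D.eval t ^ m' * D.eval t * h1
  rcases mul_eq_zero.1 hzero with h | h
  · rcases mul_eq_zero.1 h with h | h
    · have h1 := hF 0 hD0
      change _ = _ * MvPolynomial.aeval (P 0) f at h1
      rw [h, hP0, Polynomial.eval_zero] at h1
      exact mul_ne_zero (pow_ne_zero m hD0) hfx h1.symm
    · have h1 := hF' 1 hD1
      change _ = _ * MvPolynomial.aeval (P 1) g at h1
      rw [h, hP1, Polynomial.eval_zero] at h1
      exact mul_ne_zero (pow_ne_zero m' hD1) hgy h1.symm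
  · exact hD0 (by rw [h, Polynomial.eval_zero])

/-- The image of a vector under a path depends polynomially on the point of `R(d)`. -/
theorem exists_path_eq_aeval (i : ZMod n) (v : Fin (d i) → k) (m : ℕ) :
    ∃ p : Fin (d (i + (m : ZMod n))) → MvPolynomial (Coord d) k, ∀ x : Coord d → k,
      (ofPoint d x).path i m v = fun a => MvPolynomial.aeval x (p a) := by
  have htr : ∀ {j j' : ZMod n} (h : j = j') (p : Fin (d j) → MvPolynomial (Coord d) k),
      ∃ q : Fin (d j') → MvPolynomial (Coord d) k, ∀ x : Coord d → k,
        (ofPoint d x).transport h (fun a => MvPolynomial.aeval x (p a)) =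
          fun a => MvPolynomial.aeval x (q a) := by
    intro j j' h p
    subst h
    exact ⟨p, fun x => rfl⟩
  induction m with
  | zero =>
    obtain ⟨q, hq⟩ := htr (show i = i + ((0 : ℕ) : ZMod n) by simp)
      fun a => MvPolynomial.C (v a)
    refine ⟨q, fun x => ?_⟩
    rw [← hq]
    simp only [MvPolynomial.aeval_C]
    rfl
  | succ m ih =>
    obtain ⟨p, hp⟩ := ih
    obtain ⟨q, hq⟩ := htr (show i + (m : ZMod n) + 1 = i + ((m + 1 : ℕ) : ZMod n) by
      push_cast; ring) fun a => ∑ b, MvPolynomial.X ⟨i + (m : ZMod n), a, b⟩ * p b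
    refine ⟨q, fun x => ?_⟩
    rw [← hq]
    change (ofPoint d x).transport _ ((ofPoint d x).map _ ((ofPoint d x).path i m v)) = _
    rw [hp]
    congr 1
    funext a
    rw [map_sum]
    simp only [map_mul, MvPolynomial.aeval_X]
    rfl

/-- The rank of a path is lower semicontinuous: a larger rank on the orbit of `T` is seen by a
polynomial that vanishes on the orbit of `E`. -/
theorem exists_mem_vanishingIdeal_of_pathRank_lt {E T : Rep k n} (hne : (orbit d T).Nonempty)
    (i : ZMod n) (m : ℕ) (h : E.pathRank i m < T.pathRank i m) :
    ∃ p ∈ MvPolynomial.vanishingIdeal k (orbit d E),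
      p ∉ MvPolynomial.vanishingIdeal k (orbit d T) := by
  obtain ⟨x₀, hx₀⟩ := hne
  set r := T.pathRank i m with hr
  let path' : (Coord d → k) → (Fin (d i) → k) →ₗ[k] (Fin (d (i + (m : ZMod n))) → k) :=
    fun x => (ofPoint d x).path i m
  have hrank : Module.finrank k (LinearMap.range (path' x₀)) = r := hx₀.pathRank_eq i m
  let g : LinearMap.range (path' x₀) ≃ₗ[k] (Fin r → k) :=
    LinearEquiv.ofFinrankEq _ _ (by rw [hrank, Module.finrank_fin_fun])
  obtain ⟨s, hs⟩ := (path' x₀).rangeRestrict.exists_rightInverse_of_surjective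
    (LinearMap.range_rangeRestrict _)
  obtain ⟨W, hW⟩ := g.toLinearMap.exists_extend
  let U : (Fin r → k) →ₗ[k] (Fin (d i) → k) := s ∘ₗ g.symm.toLinearMap
  -- The required polynomial is `det (W ∘ path ∘ U)`: it is `1` at `x₀`, and it vanishes wherever
  -- the path has rank less than `r`.
  have hid : W ∘ₗ path' x₀ ∘ₗ U = LinearMap.id := by
    refine LinearMap.ext fun v => ?_
    have h1 := LinearMap.congr_fun hs (g.symm v)
    have h2 := LinearMap.congr_fun hW (g.symm v)
    have h3 : path' x₀ (U v) = (g.symm v : Fin (d (i + (m : ZMod n))) → k) :=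
      congrArg Subtype.val h1
    rw [LinearMap.comp_apply, LinearMap.comp_apply, h3]
    exact h2.trans (g.apply_symm_apply v)
  choose p hp using fun b : Fin r => exists_path_eq_aeval (k := k) i (U (Pi.single b 1)) m
  let Q : Matrix (Fin r) (Fin r) (MvPolynomial (Coord d) k) :=
    Matrix.of fun a b => ∑ u, MvPolynomial.C (LinearMap.toMatrix' W a u) * p b u
  have hQ : ∀ x, MvPolynomial.aeval x Q.det = LinearMap.det (W ∘ₗ path' x ∘ₗ U) := by
    intro x
    rw [← LinearMap.det_toMatrix', AlgHom.map_det]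
    congr 1
    ext a b
    have h1 : path' x (U (Pi.single b 1)) = fun u => MvPolynomial.aeval x (p b u) := hp b x
    rw [LinearMap.toMatrix'_apply, LinearMap.comp_apply, LinearMap.comp_apply, h1,
      ← LinearMap.toMatrix'_mulVec]
    simp [Q, Matrix.mulVec, dotProduct]
  refine ⟨Q.det, fun x hx => ?_, fun hmem => ?_⟩
  · rw [hQ]
    by_contra hdet
    have hsurj : Function.Surjective (W ∘ₗ path' x ∘ₗ U) :=
      (LinearEquiv.ofIsUnitDet (f := W ∘ₗ path' x ∘ₗ U)
        (v := Pi.basisFun k _) (v' := Pi.basisFun k _)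
        (by rw [LinearMap.det_toMatrix]; exact Ne.isUnit hdet)).surjective
    have h1 : Function.Surjective (W ∘ₗ (LinearMap.range (path' x)).subtype) := by
      intro v
      obtain ⟨w, hw⟩ := hsurj v
      exact ⟨⟨path' x (U w), ⟨_, rfl⟩⟩, hw⟩
    have h2 := LinearMap.finrank_le_finrank_of_surjective h1
    rw [Module.finrank_fin_fun] at h2
    have h3 : Module.finrank k (LinearMap.range (path' x)) = E.pathRank i m :=
      IsIso.pathRank_eq hx i m
    omega
  · have h1 := hmem x₀ hx₀
    rw [hQ, hid, LinearMap.det_id] at h1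
    exact one_ne_zero h1

theorem zariskiDim_add_one_le {σ : Type} {S S' : Set (σ → k)}
    (hle : MvPolynomial.vanishingIdeal k S' ≤ MvPolynomial.vanishingIdeal k S)
    (hprime : (MvPolynomial.vanishingIdeal k S').IsPrime)
    (h : ∃ p ∈ MvPolynomial.vanishingIdeal k S, p ∉ MvPolynomial.vanishingIdeal k S') :
    zariskiDim S + 1 ≤ zariskiDim S' := by
  obtain ⟨p, hp, hp'⟩ := h
  refine ringKrullDim_succ_le_of_surjective (Ideal.Quotient.factor hle)
    (Ideal.Quotient.factor_surjective hle) (r := Ideal.Quotient.mk _ p) ?_ ?_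
  · exact mem_nonZeroDivisors_of_ne_zero fun h => hp' (Ideal.Quotient.eq_zero_iff_mem.1 h)
  · rw [Ideal.Quotient.factor_mk]
    exact Ideal.Quotient.eq_zero_iff_mem.2 hp

theorem zariskiDim_ne_top {σ : Type} [Finite σ] (S : Set (σ → k)) : zariskiDim S ≠ ⊤ := by
  refine ne_of_lt ((ringKrullDim_quotient_le _).trans_lt ?_)
  rw [MvPolynomial.ringKrullDim_of_isNoetherianRing, ringKrullDim_eq_zero_of_field, zero_add]
  exact WithBot.coe_lt_coe.2 (ENat.natCast_lt_top _)

end Geometry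

/-! ### Extensions of `S_i` by `M(π)` -/

section Main

variable {k : Type u} [Field k] {n : ℕ}

/-- The summand of `M(π)` with top at `v` that belongs to the largest column of `π v`; it is the
added zero summand if `π v` is empty. -/
theorem exists_labelZero_eq (π : MultiPart n) (v : ZMod n) :
    ∃ s, labelZero π v s = (v, (π v).dual.parts 0) := by
  by_cases h : 0 < (π v).parts 0
  · exact ⟨some ⟨v, ⟨0, h⟩⟩, rfl⟩
  · refine ⟨none, ?_⟩
    have := (π v).lt_dual_zero_iff 0
    have h0 : (π v).dual.parts 0 = 0 := by omega
    rw [h0]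
    rfl

theorem labelZero_snd_le (π : MultiPart n) (v : ZMod n)
    (s : Option (Σ i : ZMod n, Fin ((π i).parts 0))) (hs : (labelZero π v s).1 = v) :
    (labelZero π v s).2 ≤ (π v).dual.parts 0 := by
  rcases s with _ | ⟨j, c⟩
  · exact Nat.zero_le _
  · change j = v at hs
    subst hs
    exact (π j).dual.antitone (Nat.zero_le _)

theorem IsIso.orbitDim_eq {M N : Rep k n} (h : IsIso M N) : M.orbitDim = N.orbitDim := by
  rw [orbitDim, orbitDim, h.dimVec_eq]
  congr 1
  exact Set.ext fun x => ⟨fun h' => IsIso.trans h' h, fun h' => IsIso.trans h' h.symm⟩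

variable [NeZero n]

theorem isIso_ofMultiPart_labelZero (π : MultiPart n) (v : ZMod n) :
    IsIso (ofMultiPart k π) (strings k (labelZero π v)) := by
  refine isIso_strings_of_card (L := label π) fun x hx => ?_
  obtain ⟨j, c⟩ := x
  obtain ⟨c, rfl⟩ := Nat.exists_eq_succ_of_ne_zero hx
  exact (card_label_eq π j c).trans (card_labelZero_eq π v j c).symm

/-- The orbit of `M(σ_i⁺ π)` dominates the orbits of all extensions of `S_i` by `M(π)`, and
strictly so unless the extension is isomorphic to `M(σ_i⁺ π)`. -/
theorem orbitDim_extension [Infinite k] (hn : 2 ≤ n) (i : ZMod n) (π : MultiPart n) :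
    IsExtension (ofMultiPart k (sigmaPlus i π)) (simple k i) (ofMultiPart k π) ∧
    ∀ E : Rep k n, IsExtension E (simple k i) (ofMultiPart k π) →
      IsIso E (ofMultiPart k (sigmaPlus i π)) ∨
        E.orbitDim + 1 ≤ (ofMultiPart k (sigmaPlus i π)).orbitDim := by
  classical
  set L := labelZero π (i + 1)
  set l := (π (i + 1)).dual.parts 0
  have hπ := isIso_ofMultiPart_labelZero (k := k) π (i + 1)
  obtain ⟨s₀, hs₀⟩ : ∃ s, L s = (i + 1, l) := exists_labelZero_eq π (i + 1)
  have hL : ∀ s, (L s).1 = i + 1 → (L s).2 ≤ l := labelZero_snd_le π (i + 1)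
  have hT : IsIso (strings k (Function.update L s₀ (i, l + 1)))
      (ofMultiPart k (sigmaPlus i π)) :=
    IsIso.symm (isIso_strings_of_card (card_label_sigmaPlus hn i π s₀ hs₀))
  constructor
  · have h1 := isIso_ext_strings_update (k := k) (L := L) (i := i) (s := s₀) (by rw [hs₀])
    rw [hs₀] at h1
    exact ((isExtension_ext _).of_isIso_left hπ).of_isIso (hT.symm.trans h1.symm)
  · intro E hE
    obtain ⟨θ, hθ⟩ := (hE.of_isIso_left hπ.symm).exists_isIso_ext
    rcases isIso_or_pathRank_lt hs₀ hL θ with h | h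
    · exact Or.inl (hθ.symm.trans (h.trans hT))
    · right
      rw [hθ.pathRank_eq, hT.pathRank_eq] at h
      obtain ⟨t₀, ht₀⟩ := exists_forall_isIso_ext hs₀ hL θ
      set T := ofMultiPart k (sigmaPlus i π)
      let θ₀ : ∀ j, (ext (strings k L) (simple k i) θ).V j →ₗ[k]
          (ext (strings k L) (simple k i) θ).V (j + 1) := fun j =>
        LinearMap.inl k _ _ ∘ₗ topCocycle L i s₀ j ∘ₗ LinearMap.snd k _ _
      have hline : ∀ t ≠ t₀, IsIso
          ((ext (strings k L) (simple k i) θ).addMap fun j => t • θ₀ j) T := by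
        intro t ht
        suffices h1 : IsIso ((ext (strings k L) (simple k i) θ).addMap fun j => t • θ₀ j)
            (ext (strings k L) (simple k i) fun j => θ j + t • topCocycle L i s₀ j) from
          h1.trans ((ht₀ t ht).trans hT)
        refine ⟨⟨fun j => LinearMap.id, ?_⟩, fun j => Function.bijective_id⟩
        rintro j ⟨y, z⟩
        change ((strings k L).map j y + θ j z + t • topCocycle L i s₀ j z,
          (simple k i).map j z + t • (0 : (simple k i).V (j + 1))) =
          ((strings k L).map j y + (θ j z + t • topCocycle L i s₀ j z), (simple k i).map j z)
        rw [smul_zero, add_zero, add_assoc]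
      have hdim : ∀ t ≠ t₀, E.dimVec = T.dimVec := by
        intro t ht
        rw [← hθ.dimVec_eq, ← (hline t ht).dimVec_eq]
        rfl
      obtain ⟨t, ht⟩ := exists_ne t₀
      have horb : ∀ d : ZMod n → ℕ, orbit d (ext (strings k L) (simple k i) θ) = orbit d E :=
        fun d => Set.ext fun x => ⟨fun h => IsIso.trans h hθ, fun h => IsIso.trans h hθ.symm⟩
      have hne := orbit_nonempty T
      rw [orbitDim, orbitDim, hdim t ht]
      refine zariskiDim_add_one_le ?_ (isPrime_vanishingIdeal_orbit T hne)
        (exists_mem_vanishingIdeal_of_pathRank_lt hne _ _ h)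
      rw [← horb]
      exact vanishingIdeal_orbit_le _ T θ₀ t₀ hline

theorem not_orbitDim_add_one_le (M : Rep k n) : ¬ M.orbitDim + 1 ≤ M.orbitDim := by
  obtain ⟨x, hx⟩ := orbit_nonempty M
  have htop : M.orbitDim ≠ ⊤ := zariskiDim_ne_top _
  have hbot : M.orbitDim ≠ ⊥ := by
    have : Nontrivial (MvPolynomial (Coord M.dimVec) k ⧸
        MvPolynomial.vanishingIdeal k (orbit M.dimVec M)) :=
      Ideal.Quotient.nontrivial_iff.2 fun h => by
        have := (Ideal.eq_top_iff_one _).1 h x hx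
        simp at this
    exact fun h => not_lt_of_ge ringKrullDim_nonneg_of_nontrivial
      (lt_of_eq_of_lt h (WithBot.bot_lt_coe 0))
  obtain ⟨a, ha⟩ := WithBot.ne_bot_iff_exists.1 hbot
  rw [← ha] at htop ⊢
  have ha' : a ≠ ⊤ := fun h => htop (by rw [h]; rfl)
  intro h
  have h' : a + 1 ≤ a := by exact_mod_cast h
  exact absurd h' (not_le.2 ((ENat.lt_add_one_iff ha').2 le_rfl))

end Main

end Rep

end CyclicQuiver

theorem proposition3p7 {k : Type u} [Field k] [IsAlgClosed k] {n : ℕ} [NeZero n] (hn : 2 ≤ n)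
    (i : ZMod n) (π : CyclicQuiver.MultiPart n) (G : CyclicQuiver.Rep k n) :
    CyclicQuiver.Rep.IsGenericExtension G
        (CyclicQuiver.Rep.simple k i) (CyclicQuiver.Rep.ofMultiPart k π) ↔
      CyclicQuiver.Rep.IsIso G
        (CyclicQuiver.Rep.ofMultiPart k (CyclicQuiver.sigmaPlus i π)) := by
  have : Infinite k := IsAlgClosed.instInfinite
  obtain ⟨hT, hE⟩ := CyclicQuiver.Rep.orbitDim_extension (k := k) hn i π
  have hnilp : (CyclicQuiver.Rep.ofMultiPart k (CyclicQuiver.sigmaPlus i π)).IsNilp :=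
    CyclicQuiver.Rep.isNilp_strings (CyclicQuiver.label _)
  constructor
  · rintro ⟨⟨_, hG⟩, hmax⟩
    refine (hE G hG).resolve_right fun h => ?_
    exact CyclicQuiver.Rep.not_orbitDim_add_one_le G (h.trans (hmax _ hnilp hT))
  · intro h
    refine ⟨⟨hnilp.of_isIso h, hT.of_isIso h⟩, fun E _ hEx => ?_⟩
    rw [h.orbitDim_eq]
    rcases hE E hEx with h' | h'
    · exact h'.orbitDim_eq.le
    · refine le_trans ?_ h'
      exact le_add_of_nonneg_right zero_le_one
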